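/- Let $\hbar>0$ and $\Gamma_1(z|\hbar)=\hbar^{z/\hbar}\Gamma(z/\hbar)$. For $\lambda=(\lambda_1,\lambda_2,\lambda_3)\in\mathbb R^3$ consider the Gelfand–Zetlin realization of $\mathfrak{gl}_3$ by difference operators in $\gamma=(\gamma_{11},\gamma_{21},\gamma_{22})$, with $\gamma_{3j}=\lambda_j$: $$E_{11}=\tfrac1\hbar\gamma_{11},\quad E_{22}=\tfrac1\hbar(\gamma_{21}+\gamma_{22}-\gamma_{11}),\quad E_{12}=-\tfrac1\hbar(\gamma_{11}-\gamma_{21}-\tfrac\hbar2)(\gamma_{11}-\gamma_{22}-\tfrac\hbar2)e^{-\hbar\partial_{11}},$$ $$E_{23}=-\tfrac1\hbar\sum_{i=1}^2\frac{\prod_{j=1}^3(\gamma_{2i}-\lambda_j-\frac\hbar2)}{\gamma_{2i}-\gamma_{2,3-i}}e^{-\hbar\partial_{2i}},\qquad E_{13}=[E_{12},E_{23}].$$ Left and right vectors are paired by $\langle\varphi,\psi\rangle=\int\mu\,\varphi\,\psi\,d\gamma_{11}d\gamma_{21}d\gamma_{22}$, where $\mu(\gamma)^{-1}=\Gamma(\frac{\gamma_{21}-\gamma_{22}}\hbar)\Gamma(\frac{\gamma_{22}-\gamma_{21}}\hbar)$.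 A left Whittaker vector satisfies $\langle\psi_L|E_{n+1,n}=\hbar^{-1}\langle\psi_L|$ for $n=1,2$; every constant function is one. The right Whittaker vectors are $$\psi_R^{(1,3)}=\delta(\gamma_{21}+\gamma_{22}-\gamma_{11})\,\delta(\gamma_{11}-\gamma_{21}+\tfrac\hbar2)\,\Gamma\big(\tfrac{\gamma_{21}-\gamma_{22}}\hbar\big)\Gamma\big(\tfrac{\gamma_{22}-\gamma_{21}}\hbar\big)\prod_{j=1}^3\Gamma_1(\gamma_{21}-\lambda_j+\tfrac\hbar2|\hbar),$$ $$\psi_R^{(2,3)}=\delta(\gamma_{21}+\gamma_{22}-\gamma_{11})\prod_{i=1}^2\prod_{j=1}^3\Gamma_1(\gamma_{2i}-\lambda_j+\tfrac\hbar2|\hbar);$$ they satisfy $E_{22}\psi_R=E_{12}\psi_R=0$, $E_{13}\psi_R=\hbar^{-1}\psi_R$, respectively $E_{22}\psi_R=E_{23}\psi_R=0$, $E_{13}\psi_R=-\hbar^{-1}\psi_R$. For a constant left vector $\psi_L=c$ and $x\in\mathbb R$, the parabolic Whittaker functions (at $x_1=x$, $x_2=x_3=0$) are the matrix elements $$\Psi^{(1,3)}_{\lambda;c}(x)=e^{-x}\langle\psi_L|e^{-xE_{11}}|\psi^{(1,3)}_R\rangle,\qquad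 \Psi^{(2,3)}_{\lambda;c}(x)=e^{-x}\langle\psi_L|e^{-x(E_{11}+E_{22})}|\psi^{(2,3)}_R\rangle,$$ where, after the delta functions are integrated out, the integrals are complex line integrals over $\gamma_{21}\in\epsilon-\frac\hbar2+\imath\mathbb R$, respectively $\gamma_{2i}\in\epsilon_i-\frac\hbar2+\imath\mathbb R$ ($i=1,2$), with $\epsilon,\epsilon_1,\epsilon_2>\max_j\lambda_j$. Equivalently, $$\Psi^{(1,3)}_{\lambda;c}(x)=c\int_{\epsilon+\imath\mathbb R}e^{-\gamma x/\hbar}\prod_{j=1}^3\Gamma_1(\gamma-\lambda_j|\hbar)\,d\gamma,$$ $$\Psi^{(2,3)}_{\lambda;c}(x)=c\int_{\epsilon_1+\imath\mathbb R}\int_{\epsilon_2+\imath\mathbb R}e^{-(\gamma_1+\gamma_2)x/\hbar}\,\frac{\prod_{j=1}^3\Gamma_1(\gamma_1-\lambda_j|\hbar)\Gamma_1(\gamma_2-\lambda_j|\hbar)}{\Gamma_1(\gamma_1-\gamma_2|\hbar)\Gamma_1(\gamma_2-\gamma_1|\hbar)}\,d\gamma_1d\gamma_2 .$$ **Proposition.**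 Let $\lambda,\tilde\lambda\in\mathbb R^3$ satisfy $\lambda_i=\tilde\lambda_j+\tilde\lambda_k$ whenever $i,j,k$ are distinct. Let $\epsilon>\lambda_j$ and $\epsilon_1,\epsilon_2>\tilde\lambda_j$ for all $j$, and let $x\in\mathbb R$. Then the integrals defining $\Psi^{(1,3)}_{\lambda;c}(x)$ and $\Psi^{(2,3)}_{\tilde\lambda;c}(x)$ converge absolutely. With the left Whittaker vectors normalized by $c=\frac1{2\pi\imath\hbar}$ for $(1,3)$ and $c=\frac1{2!\,(2\pi\imath\hbar)^2}$ for $(2,3)$, $$\Psi^{(1,3)}_{\lambda_1,\lambda_2,\lambda_3}(x)=\Psi^{(2,3)}_{\tilde\lambda_1,\tilde\lambda_2,\tilde\lambda_3}(x).$$ If instead $c=\frac1{2\pi\hbar}$ is used for $(2,3)$, then $\Psi^{(2,3)}_{\tilde\lambda}(x)=-4\pi\hbar\,\Psi^{(1,3)}_{\lambda}(x)$. -/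

import Mathlib

open MeasureTheory

noncomputable section

namespace GZ

/-- The modified Gamma function `Γ₁(z | ω) = ω ^ (z / ω) * Γ (z / ω)`. -/
def gammaOne (z : ℂ) (ω : ℝ) : ℂ := (ω : ℂ) ^ (z / ω) * Complex.Gamma (z / ω)

/-- The Gelfand-Zetlin variables `γ₁₁, γ₂₁, γ₂₂` of `gl₃`. The bottom row `γ₃ⱼ = λⱼ` is a
parameter. -/
@[ext]
structure Pt where
  g11 : ℂ
  g21 : ℂ
  g22 : ℂ

/-- Elements of the representation space. A distribution `∑ₖ Fₖ(γ) δ_{Sₖ}`, where the `Sₖ` are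
disjoint translates of an affine subspace `S` and `δ_{Sₖ}` are the translates of the delta function
of `S`, is encoded by the function equal to `Fₖ` on `Sₖ` and to `0` off the union of the `Sₖ`.
Multiplication by functions and shifts of the arguments are then given by the formulas
for ordinary functions. -/
abbrev Vec : Type := Pt → ℂ

/-! ### The Gelfand-Zetlin realization of `gl₃` by difference operators -/

/-- `E₁₁ = γ₁₁ / ħ`. -/
def E11 (h : ℝ) (φ : Vec) : Vec := fun g => g.g11 / h * φ g

/-- `E₂₂ = (γ₂₁ + γ₂₂ - γ₁₁) / ħ`. -/
def E22 (h : ℝ) (φ : Vec) : Vec := fun g => (g.g21 + g.g22 - g.g11) / h * φ g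

/-- The operator `E₁₂ = -ħ⁻¹ (γ₁₁ - γ₂₁ - ħ/2)(γ₁₁ - γ₂₂ - ħ/2) exp(-ħ ∂₁₁)`. -/
def E12 (h : ℝ) (φ : Vec) : Vec := fun g =>
  -(1 / (h : ℂ)) * ((g.g11 - g.g21 - h / 2) * (g.g11 - g.g22 - h / 2) *
    φ ⟨g.g11 - h, g.g21, g.g22⟩)

/-- The operator
`E₂₃ = -ħ⁻¹ ∑ᵢ ∏ⱼ (γ₂ᵢ - λⱼ - ħ/2) / ∏_{s ≠ i} (γ₂ᵢ - γ₂ₛ) exp(-ħ ∂₂ᵢ)`. -/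
def E23 (h : ℝ) (lam : Fin 3 → ℝ) (φ : Vec) : Vec := fun g =>
  -(1 / (h : ℂ)) *
    ((∏ j, (g.g21 - lam j - h / 2)) / (g.g21 - g.g22) * φ ⟨g.g11, g.g21 - h, g.g22⟩ +
     (∏ j, (g.g22 - lam j - h / 2)) / (g.g22 - g.g21) * φ ⟨g.g11, g.g21, g.g22 - h⟩)

/-- `E₁₃ = [E₁₂, E₂₃]`. -/
def E13 (h : ℝ) (lam : Fin 3 → ℝ) (φ : Vec) : Vec :=
  E12 h (E23 h lam φ) - E23 h lam (E12 h φ)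

/-- The density `μ(γ) = 1 / (Γ((γ₂₁ - γ₂₂)/ħ) Γ((γ₂₂ - γ₂₁)/ħ))` of the pairing. It is an entire
function; its zeros at the poles of the Gamma functions agree with Lean's conventions
`Γ(-n) = 0` and `0⁻¹ = 0`. -/
def mu (h : ℝ) (g : Pt) : ℂ :=
  (Complex.Gamma ((g.g21 - g.g22) / h) * Complex.Gamma ((g.g22 - g.g21) / h))⁻¹

/-- The conjugated lowering generator `E₂₁† = ħ⁻¹ exp(-ħ ∂₁₁)`, which gives the action on
left vectors. -/
def E21dag (h : ℝ) (φ : Vec) : Vec := fun g => 1 / (h : ℂ) * φ ⟨g.g11 - h, g.g21, g.g22⟩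

/-- The conjugated lowering generator `E₃₂†`, which gives the action on left vectors. -/
def E32dag (h : ℝ) (φ : Vec) : Vec := fun g =>
  1 / (h : ℂ) *
    ((g.g21 - g.g11 - h / 2) / (g.g21 - g.g22) * φ ⟨g.g11, g.g21 - h, g.g22⟩ +
     (g.g22 - g.g11 - h / 2) / (g.g22 - g.g21) * φ ⟨g.g11, g.g21, g.g22 - h⟩)

/-- Points off the polar hyperplanes of the coefficients and of the Gamma functions. Identities
between meromorphic functions are asserted at these points. -/
def Generic (h : ℝ) (lam : Fin 3 → ℝ) (g : Pt) : Prop :=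
  (∀ n : ℤ, g.g21 - g.g22 ≠ n * h) ∧
    ∀ (j : Fin 3) (n : ℤ),
      g.g21 - lam j ≠ (n + 1 / 2 : ℂ) * h ∧ g.g22 - lam j ≠ (n + 1 / 2 : ℂ) * h

/-! ### Whittaker vectors -/

/-- Left Whittaker vector: `⟨ψ_L| E_{n+1,n} = ħ⁻¹ ⟨ψ_L|` for `n = 1, 2`. -/
structure IsLeftWhittaker (h : ℝ) (lam : Fin 3 → ℝ) (φ : Vec) : Prop where
  e21 : ∀ g, Generic h lam g → E21dag h φ g = 1 / (h : ℂ) * φ g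
  e32 : ∀ g, Generic h lam g → E32dag h φ g = 1 / (h : ℂ) * φ g

/-- Right `(1,3)`-Whittaker vector:
`E₂₂ ψ_R = 0`, `E₁₂ ψ_R = 0`, `E₁₃ ψ_R = ħ⁻¹ ψ_R`. -/
structure IsRightWhittaker13 (h : ℝ) (lam : Fin 3 → ℝ) (ψ : Vec) : Prop where
  e22 : ∀ g, Generic h lam g → E22 h ψ g = 0
  e12 : ∀ g, Generic h lam g → E12 h ψ g = 0
  e13 : ∀ g, Generic h lam g → E13 h lam ψ g = 1 / (h : ℂ) * ψ g

/-- Right `(2,3)`-Whittaker vector: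
`E₂₂ ψ_R = 0`, `E₂₃ ψ_R = 0`, `E₁₃ ψ_R = -ħ⁻¹ ψ_R`. -/
structure IsRightWhittaker23 (h : ℝ) (lam : Fin 3 → ℝ) (ψ : Vec) : Prop where
  e22 : ∀ g, Generic h lam g → E22 h ψ g = 0
  e23 : ∀ g, Generic h lam g → E23 h lam ψ g = 0
  e13 : ∀ g, Generic h lam g → E13 h lam ψ g = -(1 / (h : ℂ)) * ψ g

/-- The left Whittaker vector: a constant function. The defining equations
determine the constant only up to normalization. -/
def leftVec (c : ℂ) : Vec := fun _ => c

open Classical in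
/-- The right `(1,3)`-Whittaker vector
`δ(γ₂₁ + γ₂₂ - γ₁₁) δ(γ₁₁ - γ₂₁ + ħ/2) Γ((γ₂₁ - γ₂₂)/ħ) Γ((γ₂₂ - γ₂₁)/ħ) ∏ⱼ Γ₁(γ₂₁ - λⱼ + ħ/2 | ħ)`.
-/
def rightVec13 (h : ℝ) (lam : Fin 3 → ℝ) : Vec := fun g =>
  if g.g21 + g.g22 - g.g11 = 0 ∧ g.g11 - g.g21 + h / 2 = 0 then
    Complex.Gamma ((g.g21 - g.g22) / h) * Complex.Gamma ((g.g22 - g.g21) / h) *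
      ∏ j, gammaOne (g.g21 - lam j + h / 2) h
  else 0

open Classical in
/-- The right `(2,3)`-Whittaker vector
`δ(γ₂₁ + γ₂₂ - γ₁₁) ∏ᵢ ∏ⱼ Γ₁(γ₂ᵢ - λⱼ + ħ/2 | ħ)`. -/
def rightVec23 (h : ℝ) (lam : Fin 3 → ℝ) : Vec := fun g =>
  if g.g21 + g.g22 - g.g11 = 0 then
    ∏ j, (gammaOne (g.g21 - lam j + h / 2) h * gammaOne (g.g22 - lam j + h / 2) h)
  else 0

/-! ### Matrix elements -/

/-- The action of the one-parameter group `exp (-x A)` generated by a (diagonal) operator `A`, as the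
exponential series. -/
def expAct (x : ℝ) (A : Vec → Vec) (ψ : Vec) : Vec := fun g =>
  ∑' n : ℕ, (-(x : ℂ)) ^ n / (n.factorial : ℂ) * (A^[n] ψ) g

/-- The integrand of `⟨φ, ψ⟩ = ∫ μ φ ψ dγ₁₁ dγ₂₁ dγ₂₂` for `ψ` with the same delta functions
`δ(γ₂₁ + γ₂₂ - γ₁₁) δ(γ₁₁ - γ₂₁ + ħ/2)` as `rightVec13`, after these have been integrated out,
at `γ₂₁ = ε - ħ/2 + i t`. -/
def integrand13 (h ε : ℝ) (φ ψ : Vec) (t : ℝ) : ℂ :=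
  let γ : ℂ := (ε - h / 2 : ℝ) + t * Complex.I
  let g : Pt := ⟨γ - h / 2, γ, -(h / 2)⟩
  mu h g * φ g * ψ g

/-- `⟨φ, ψ⟩` for the delta functions of `rightVec13`: the contour integral over
`γ₂₁ ∈ ε - ħ/2 + iℝ`, with `dγ₂₁ = i dt`. -/
def pairing13 (h ε : ℝ) (φ ψ : Vec) : ℂ :=
  Complex.I * ∫ t : ℝ, integrand13 h ε φ ψ t

/-- The integrand of `⟨φ, ψ⟩ = ∫ μ φ ψ dγ₁₁ dγ₂₁ dγ₂₂` for `ψ` with the same delta function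
`δ(γ₂₁ + γ₂₂ - γ₁₁)` as `rightVec23`, after this has been integrated out,
at `γ₂₁ = ε₁ - ħ/2 + i t₁`, `γ₂₂ = ε₂ - ħ/2 + i t₂`. -/
def integrand23 (h ε₁ ε₂ : ℝ) (φ ψ : Vec) (t : ℝ × ℝ) : ℂ :=
  let γ₁ : ℂ := (ε₁ - h / 2 : ℝ) + t.1 * Complex.I
  let γ₂ : ℂ := (ε₂ - h / 2 : ℝ) + t.2 * Complex.I
  let g : Pt := ⟨γ₁ + γ₂, γ₁, γ₂⟩
  mu h g * φ g * ψ g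

/-- `⟨φ, ψ⟩` for the delta function of `rightVec23`: the contour integral over
`(γ₂₁, γ₂₂) ∈ (ε₁ - ħ/2 + iℝ) × (ε₂ - ħ/2 + iℝ)`, with `dγ₂₁ dγ₂₂ = i² dt₁ dt₂`. -/
def pairing23 (h ε₁ ε₂ : ℝ) (φ ψ : Vec) : ℂ :=
  Complex.I ^ 2 * ∫ t : ℝ × ℝ, integrand23 h ε₁ ε₂ φ ψ t

/-- The vector `π(exp (-x E₁₁)) |ψ_R⟩` of the `(1,3)` case. -/
def translated13 (h : ℝ) (lam : Fin 3 → ℝ) (x : ℝ) : Vec :=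
  expAct x (E11 h) (rightVec13 h lam)

/-- The vector `π(exp (-x (E₁₁ + E₂₂))) |ψ_R⟩` of the `(2,3)` case. -/
def translated23 (h : ℝ) (lam : Fin 3 → ℝ) (x : ℝ) : Vec :=
  expAct x (fun φ => E11 h φ + E22 h φ) (rightVec23 h lam)

/-- The `(1,3)`-Whittaker function `e^{-x} ⟨ψ_L| π(exp (-x E₁₁)) |ψ_R⟩` (at `x₁ = x`,
`x₂ = x₃ = 0`), for the left Whittaker vector `⟨ψ_L| = c`. -/
def whittaker13 (c : ℂ) (h : ℝ) (lam : Fin 3 → ℝ) (ε x : ℝ) : ℂ :=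
  Complex.exp (-x) * pairing13 h ε (leftVec c) (translated13 h lam x)

/-- The `(2,3)`-Whittaker function `e^{-x} ⟨ψ_L| π(exp (-x (E₁₁ + E₂₂))) |ψ_R⟩` (at `x₁ = x`,
`x₂ = x₃ = 0`), for the left Whittaker vector `⟨ψ_L| = c`. -/
def whittaker23 (c : ℂ) (h : ℝ) (lam : Fin 3 → ℝ) (ε₁ ε₂ x : ℝ) : ℂ :=
  Complex.exp (-x) * pairing23 h ε₁ ε₂ (leftVec c) (translated23 h lam x)

/-! ### The vectors above are Whittaker vectors -/

theorem gammaOne_add {h : ℝ} (hh : 0 < h) {z : ℂ} (hz : z ≠ 0) :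
    gammaOne (z + h) h = z * gammaOne z h := by
  have hc : (h : ℂ) ≠ 0 := by exact_mod_cast hh.ne'
  unfold gammaOne
  rw [add_div, div_self hc, Complex.Gamma_add_one _ (div_ne_zero hz hc),
    Complex.cpow_add _ _ hc, Complex.cpow_one]
  field_simp

theorem leftVec_isLeftWhittaker {h : ℝ} (lam : Fin 3 → ℝ) (c : ℂ) :
    IsLeftWhittaker h lam (leftVec c) := by
  refine ⟨fun g _ => rfl, fun g hg => ?_⟩
  have h1 : g.g21 - g.g22 ≠ 0 := by simpa using hg.1 0
  have h2 : g.g22 - g.g21 ≠ 0 := by rw [← neg_sub]; exact neg_ne_zero.2 h1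
  have h3 : g.g22 - g.g21 = -(g.g21 - g.g22) := by ring
  simp only [E32dag, leftVec]
  rw [h3, div_neg]
  field_simp
  ring

theorem gammaOne_shift {h : ℝ} (hh : 0 < h) {lam : Fin 3 → ℝ} {y : ℂ}
    (hy : ∀ (j : Fin 3) (n : ℤ), y - lam j ≠ (n + 1 / 2 : ℂ) * h) (j : Fin 3) :
    (y - lam j - h / 2) * gammaOne (y - h - lam j + h / 2) h
      = gammaOne (y - lam j + h / 2) h := by
  have hz : y - lam j - h / 2 ≠ 0 := by
    intro h0
    apply hy j 0
    push_cast
    linear_combination h0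
  have := gammaOne_add hh hz
  rw [show y - lam j - h / 2 + h = y - lam j + h / 2 by ring] at this
  rw [this, show y - h - lam j + h / 2 = y - lam j - h / 2 by ring]

theorem prod_shift {h : ℝ} (hh : 0 < h) {lam : Fin 3 → ℝ} {y : ℂ}
    (hy : ∀ (j : Fin 3) (n : ℤ), y - lam j ≠ (n + 1 / 2 : ℂ) * h) :
    (∏ j, (y - lam j - h / 2)) * ∏ j, gammaOne (y - h - lam j + h / 2) h
      = ∏ j, gammaOne (y - lam j + h / 2) h := by
  rw [← Finset.prod_mul_distrib]
  exact Finset.prod_congr rfl fun j _ => gammaOne_shift hh hy j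

theorem Gamma_mul_shift {u : ℂ} (h0 : u ≠ 0) (h1 : u - 1 ≠ 0) :
    (u - 1) * (Complex.Gamma (u - 1) * Complex.Gamma (-(u - 1)))
      = -u * (Complex.Gamma u * Complex.Gamma (-u)) := by
  have e1 := Complex.Gamma_add_one (u - 1) h1
  have e2 := Complex.Gamma_add_one (-u) (neg_ne_zero.2 h0)
  rw [sub_add_cancel] at e1
  rw [show -(u - 1) = -u + 1 by ring, e2, e1]
  ring

theorem rightVec13_isRightWhittaker13 {h : ℝ} (hh : 0 < h) (lam : Fin 3 → ℝ) :
    IsRightWhittaker13 h lam (rightVec13 h lam) := by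
  have hc : (h : ℂ) ≠ 0 := by exact_mod_cast hh.ne'
  have h12 : ∀ g, E12 h (rightVec13 h lam) g = 0 := by
    intro g
    simp only [E12, rightVec13]
    split_ifs with hs
    · have : g.g11 - g.g21 - h / 2 = 0 := by linear_combination hs.2
      rw [this]; ring
    · ring
  refine ⟨fun g _ => ?_, fun g _ => h12 g, fun g hg => ?_⟩
  · simp only [E22, rightVec13]
    split_ifs with hs
    · rw [hs.1]; ring
    · ring
  have hz : E23 h lam (E12 h (rightVec13 h lam)) g = 0 := by
    simp only [E23, h12]; ring
  have h1 : g.g21 - g.g22 ≠ 0 := by simpa using hg.1 0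
  have h3 : g.g21 - g.g22 - h ≠ 0 := by
    intro e; apply hg.1 1; push_cast; linear_combination e
  rw [E13, Pi.sub_apply, hz, sub_zero]
  simp only [E12, E23, rightVec13]
  -- the term shifting `γ₂₂` is killed by the factor of `E₁₂`
  have hkill : (g.g11 - g.g21 - h / 2) *
      (if g.g21 + (g.g22 - h) - (g.g11 - h) = 0 ∧ g.g11 - h - g.g21 + h / 2 = 0 then
        Complex.Gamma ((g.g21 - (g.g22 - h)) / h) * Complex.Gamma ((g.g22 - h - g.g21) / h) *
          ∏ j, gammaOne (g.g21 - lam j + h / 2) h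
      else 0) = 0 := by
    split_ifs with hs
    · have : g.g11 - g.g21 - h / 2 = 0 := by linear_combination hs.2
      rw [this]; ring
    · ring
  generalize (if g.g21 + (g.g22 - h) - (g.g11 - h) = 0 ∧ g.g11 - h - g.g21 + h / 2 = 0 then
        Complex.Gamma ((g.g21 - (g.g22 - h)) / h) * Complex.Gamma ((g.g22 - h - g.g21) / h) *
          ∏ j, gammaOne (g.g21 - lam j + h / 2) h
      else 0) = Z at *
  by_cases hs : g.g21 + g.g22 - g.g11 = 0 ∧ g.g11 - g.g21 + h / 2 = 0
  · have hs' : g.g21 - h + g.g22 - (g.g11 - h) = 0 ∧ g.g11 - h - (g.g21 - h) + h / 2 = 0 :=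
      ⟨by linear_combination hs.1, by linear_combination hs.2⟩
    rw [if_pos hs, if_pos hs']
    have hp := prod_shift hh (fun j n => (hg.2 j n).1)
    have hG := Gamma_mul_shift (u := (g.g21 - g.g22) / h) (div_ne_zero h1 hc)
      (by rw [div_sub_one hc]; exact div_ne_zero h3 hc)
    have a1 : (g.g21 - g.g22) / (h : ℂ) - 1 = (g.g21 - h - g.g22) / h := by
      field_simp; ring
    have a2 : -((g.g21 - h - g.g22) / (h : ℂ)) = (g.g22 - (g.g21 - h)) / h := by
      field_simp; ring
    have a3 : -((g.g21 - g.g22) / (h : ℂ)) = (g.g22 - g.g21) / h := by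
      field_simp; ring
    rw [a1, a2, a3] at hG
    have f1 : g.g11 - g.g21 - h / 2 = -h := by linear_combination hs.2
    have f2 : g.g11 - g.g22 - h / 2 = g.g21 - h - g.g22 := by
      linear_combination hs.2
    rw [← hp]
    rw [f2]
    rw [f1] at hkill ⊢
    have hZ : Z = 0 := by
      rcases mul_eq_zero.1 hkill with q | q
      · exact absurd q (neg_ne_zero.2 hc)
      · exact q
    rw [hZ]
    generalize Complex.Gamma ((g.g21 - h - g.g22) / h) *
      Complex.Gamma ((g.g22 - (g.g21 - h)) / h) = X at *
    generalize Complex.Gamma ((g.g21 - g.g22) / h) *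
      Complex.Gamma ((g.g22 - g.g21) / h) = Y at *
    generalize (∏ j, (g.g21 - (lam j : ℂ) - h / 2)) = A
    generalize (∏ j, gammaOne (g.g21 - h - lam j + h / 2) h) = B
    field_simp at hG ⊢
    linear_combination -(A * B) * hG
  · have hs' : ¬ (g.g21 - h + g.g22 - (g.g11 - h) = 0 ∧
        g.g11 - h - (g.g21 - h) + h / 2 = 0) := by
      rintro ⟨q1, q2⟩
      exact hs ⟨by linear_combination q1, by linear_combination q2⟩
    rw [if_neg hs, if_neg hs']
    linear_combination (1 / (h : ℂ)) ^ 2 * (g.g11 - g.g22 - h / 2) *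
        ((∏ j, (g.g22 - lam j - h / 2)) / (g.g22 - g.g21)) * hkill

theorem rightVec23_isRightWhittaker23 {h : ℝ} (hh : 0 < h) (lam : Fin 3 → ℝ) :
    IsRightWhittaker23 h lam (rightVec23 h lam) := by
  have hc : (h : ℂ) ≠ 0 := by exact_mod_cast hh.ne'
  have key : ∀ g, Generic h lam g → E23 h lam (rightVec23 h lam) g = 0 ∧
      E23 h lam (E12 h (rightVec23 h lam)) g = 1 / (h : ℂ) * rightVec23 h lam g := by
    intro g hg
    have h1 : g.g21 - g.g22 ≠ 0 := by simpa using hg.1 0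
    have hr : g.g22 - g.g21 = -(g.g21 - g.g22) := by ring
    have hp1 := prod_shift hh (fun j n => (hg.2 j n).1)
    have hp2 := prod_shift hh (fun j n => (hg.2 j n).2)
    simp only [E23, E12, rightVec23, Finset.prod_mul_distrib, hr, div_neg, ← hp1, ← hp2]
    generalize (∏ j, (g.g21 - (lam j : ℂ) - h / 2)) = A
    generalize (∏ j, gammaOne (g.g21 - h - lam j + h / 2) h) = B
    generalize (∏ j, (g.g22 - (lam j : ℂ) - h / 2)) = C
    generalize (∏ j, gammaOne (g.g22 - h - lam j + h / 2) h) = D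
    constructor
    · have hiff : (g.g21 - h + g.g22 - g.g11 = 0) = (g.g21 + (g.g22 - h) - g.g11 = 0) := by
        congr 1; ring
      simp only [hiff]
      split_ifs
      · field_simp; ring
      · ring
    · have q1 : (g.g21 - h + g.g22 - (g.g11 - h) = 0) = (g.g21 + g.g22 - g.g11 = 0) := by
        congr 1; ring
      have q2 : (g.g21 + (g.g22 - h) - (g.g11 - h) = 0) = (g.g21 + g.g22 - g.g11 = 0) := by
        congr 1; ring
      simp only [q1, q2]
      split_ifs with hs
      · have e : g.g11 = g.g21 + g.g22 := by linear_combination -hs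
        rw [e]
        field_simp
        ring
      · ring
  refine ⟨fun g _ => ?_, fun g hg => (key g hg).1, fun g hg => ?_⟩
  · simp only [E22, rightVec23]
    split_ifs with hs
    · rw [hs]; ring
    · ring
  · have hz : E12 h (E23 h lam (rightVec23 h lam)) g = 0 := by
      have := (key ⟨g.g11 - h, g.g21, g.g22⟩ hg).1
      rw [E12, this]; ring
    rw [E13, Pi.sub_apply, hz, (key g hg).2]; ring

/-! ### Mellin-Barnes form of the matrix elements -/

theorem expAct_eq (x : ℝ) (A : Vec → Vec) (a : Pt → ℂ) (hA : ∀ φ g, A φ g = a g * φ g) (ψ : Vec)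
    (g : Pt) : expAct x A ψ g = Complex.exp (-x * a g) * ψ g := by
  have hit : ∀ n : ℕ, (A^[n] ψ) g = a g ^ n * ψ g := by
    intro n
    induction n with
    | zero => simp
    | succ n ih => rw [Function.iterate_succ_apply', hA, ih]; ring
  unfold expAct
  simp only [hit]
  rw [Complex.exp_eq_exp_ℂ, NormedSpace.exp_eq_tsum_div, ← tsum_mul_right]
  refine tsum_congr fun n => ?_
  rw [mul_pow]; ring

/-- The matrix element is the integral `c ∫ exp(-γ x/ħ) ∏ⱼ Γ₁(γ - λⱼ | ħ) dγ` over `ε + iℝ`. -/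
theorem whittaker13_eq {h : ℝ} (hh : 0 < h) (c : ℂ) (lam : Fin 3 → ℝ) (ε x : ℝ) :
    whittaker13 c h lam ε x = c * Complex.I * ∫ t : ℝ,
      Complex.exp (-(ε + t * Complex.I) * x / h) *
        ∏ j, gammaOne (ε + t * Complex.I - lam j) h := by
  have hc : (h : ℂ) ≠ 0 := by exact_mod_cast hh.ne'
  unfold whittaker13 pairing13
  simp only [← integral_const_mul]
  refine integral_congr_ae ?_
  have hae : ∀ᵐ t : ℝ, t ≠ 0 := by simp [ae_iff]
  filter_upwards [hae] with t ht
  simp only [integrand13, translated13, leftVec]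
  rw [expAct_eq x (E11 h) (fun g => g.g11 / h) (fun _ _ => rfl)]
  simp only [rightVec13, mu]
  rw [if_pos ⟨by ring, by ring⟩]
  have hu : ∀ n : ℕ, ((((ε - h / 2 : ℝ) : ℂ) + t * Complex.I) - -(h / 2)) / h ≠ -n := by
    intro n e
    rw [div_eq_iff hc] at e
    have := congrArg Complex.im e
    simp at this
    exact ht this
  have hu' : ∀ n : ℕ, (-(h / 2) - (((ε - h / 2 : ℝ) : ℂ) + t * Complex.I)) / h ≠ -n := by
    intro n e
    rw [div_eq_iff hc] at e
    have := congrArg Complex.im e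
    simp at this
    exact ht this
  have G1 := Complex.Gamma_ne_zero hu
  have G2 := Complex.Gamma_ne_zero hu'
  simp only [show ∀ j : Fin 3, (((ε - h / 2 : ℝ) : ℂ) + t * Complex.I) - lam j + h / 2
      = ε + t * Complex.I - lam j by intro j; push_cast; ring]
  have E : Complex.exp (-(ε + t * Complex.I) * x / h) = Complex.exp (-x) * Complex.exp
      (-x * ((((ε - h / 2 : ℝ) : ℂ) + t * Complex.I - h / 2) / h)) := by
    rw [← Complex.exp_add]
    congr 1
    push_cast
    field_simp
    ring
  rw [E]
  generalize Complex.Gamma ((((ε - h / 2 : ℝ) : ℂ) + t * Complex.I - -(h / 2)) / h) = X at *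
  generalize Complex.Gamma ((-(h / 2) - (((ε - h / 2 : ℝ) : ℂ) + t * Complex.I)) / h) = Y at *
  field_simp

/-- The matrix element is the integral
`c ∬ exp(-(γ₁+γ₂) x/ħ) ∏ⱼ Γ₁(γ₁ - λⱼ | ħ) Γ₁(γ₂ - λⱼ | ħ) / (Γ₁(γ₁ - γ₂ | ħ) Γ₁(γ₂ - γ₁ | ħ)) dγ₁ dγ₂`
over `(ε₁ + iℝ) × (ε₂ + iℝ)`. -/
theorem whittaker23_eq {h : ℝ} (hh : 0 < h) (c : ℂ) (lam : Fin 3 → ℝ) (ε₁ ε₂ x : ℝ) :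
    whittaker23 c h lam ε₁ ε₂ x = c * Complex.I ^ 2 * ∫ t : ℝ × ℝ,
      Complex.exp (-(ε₁ + t.1 * Complex.I + (ε₂ + t.2 * Complex.I)) * x / h) *
        (∏ j, (gammaOne (ε₁ + t.1 * Complex.I - lam j) h *
          gammaOne (ε₂ + t.2 * Complex.I - lam j) h)) /
        (gammaOne (ε₁ + t.1 * Complex.I - (ε₂ + t.2 * Complex.I)) h *
          gammaOne (ε₂ + t.2 * Complex.I - (ε₁ + t.1 * Complex.I)) h) := by
  have hc : (h : ℂ) ≠ 0 := by exact_mod_cast hh.ne'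
  unfold whittaker23 pairing23
  simp only [← integral_const_mul]
  refine integral_congr_ae (Filter.Eventually.of_forall fun t => ?_)
  simp only [integrand23, translated23, leftVec]
  rw [expAct_eq x _ (fun g => (g.g21 + g.g22) / h)
    (fun φ g => by simp only [Pi.add_apply, E11, E22]; ring)]
  simp only [rightVec23, mu]
  rw [if_pos (by ring)]
  simp only [show ∀ j : Fin 3, (((ε₁ - h / 2 : ℝ) : ℂ) + t.1 * Complex.I) - lam j + h / 2
      = ε₁ + t.1 * Complex.I - lam j by intro j; push_cast; ring]
  simp only [show ∀ j : Fin 3, (((ε₂ - h / 2 : ℝ) : ℂ) + t.2 * Complex.I) - lam j + h / 2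
      = ε₂ + t.2 * Complex.I - lam j by intro j; push_cast; ring]
  have E : Complex.exp (-(ε₁ + t.1 * Complex.I + (ε₂ + t.2 * Complex.I)) * x / h)
      = Complex.exp (-x) * Complex.exp
      (-x * ((((ε₁ - h / 2 : ℝ) : ℂ) + t.1 * Complex.I +
        (((ε₂ - h / 2 : ℝ) : ℂ) + t.2 * Complex.I)) / h)) := by
    rw [← Complex.exp_add]
    congr 1
    push_cast
    field_simp
    ring
  rw [E]
  have D : ∀ u v : ℂ, gammaOne (u - v) h * gammaOne (v - u) h =
      Complex.Gamma ((u - v) / h) * Complex.Gamma ((v - u) / h) := by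
    intro u v
    have : (h : ℂ) ^ ((u - v) / h) * (h : ℂ) ^ ((v - u) / h) = 1 := by
      rw [← Complex.cpow_add _ _ hc, ← add_div, sub_add_sub_cancel, sub_self, zero_div,
        Complex.cpow_zero]
    unfold gammaOne
    linear_combination (Complex.Gamma ((u - v) / h) * Complex.Gamma ((v - u) / h)) * this
  rw [D]
  have s1 : (((ε₁ - h / 2 : ℝ) : ℂ) + t.1 * Complex.I) - (((ε₂ - h / 2 : ℝ) : ℂ) + t.2 * Complex.I)
      = ε₁ + t.1 * Complex.I - (ε₂ + t.2 * Complex.I) := by push_cast; ring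
  have s2 : (((ε₂ - h / 2 : ℝ) : ℂ) + t.2 * Complex.I) - (((ε₁ - h / 2 : ℝ) : ℂ) + t.1 * Complex.I)
      = ε₂ + t.2 * Complex.I - (ε₁ + t.1 * Complex.I) := by push_cast; ring
  rw [s1, s2]
  ring

end GZ

end

namespace GZ

open Complex Filter Topology

/-! ### Exponential bounds for the Gamma function on vertical strips -/

/-! Measure the variables in units of `h`. In the double integral take as new variables the sum `s =
γ₁ + γ₂` and half the difference `z = (γ₁ - γ₂) / 2`. The exponential depends on `s` only, and what
is left is the continuous dual Hahn weight in `z` with parameters `a, b, c = s/2 - λ̃ⱼ`. Its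
integral over `z` is a constant times `Γ(a+b) Γ(a+c) Γ(b+c)`. Since `a + b = s - (λ̃₁ + λ̃₂) = s -
λ₃` and likewise for the other pairs, this product is the integrand of the single Mellin-Barnes
integral at `s`; see `integral_barnesKernel_diagonal` and `integral_barnesKernel`.

The dual Hahn integral `J(a, b, c)` (`integral_dualHahn`) is evaluated by periodicity. A contour
shift gives `J(a+1, b, c) = (a+b)(a+c) J(a, b, c)`, so `J / (Γ(a+b) Γ(a+c))` has period `1` in `a`.
It is holomorphic for `Re a > 0` and grows at most like `exp(π |Im a|)`. A function of period `1`
growing slower than `exp(2π |Im a|)` has only its constant Fourier mode, so the ratio does not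
depend on `a`. By symmetry all three parameters can be moved to `(1, 1/2, 1/2)`, where the weight is
elementary.

The analysis rests on bounds for `Γ` in vertical strips, with any decay rate close enough to `π/2`.
They follow from the reflection formula on `Re = 1/2` and a monotonicity property that comes from
the Beta integral. -/

theorem norm_betaIntegral_le {s : ℂ} (w : ℝ) :
    ‖betaIntegral s w‖ ≤ ‖betaIntegral (s.re : ℂ) w‖ := by
  have key : ∀ x ∈ Set.Ioo (0 : ℝ) 1, ‖(x : ℂ) ^ (s - 1) * (1 - (x : ℂ)) ^ ((w : ℂ) - 1)‖
      = x ^ (s.re - 1) * (1 - x) ^ (w - 1) := by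
    intro x hx
    have h1 : (1 : ℂ) - x = ((1 - x : ℝ) : ℂ) := by push_cast; ring
    rw [norm_mul, h1, norm_cpow_eq_rpow_re_of_pos hx.1,
      norm_cpow_eq_rpow_re_of_pos (sub_pos.2 hx.2)]
    simp
  have e : betaIntegral (s.re : ℂ) w =
      ((∫ x in (0 : ℝ)..1, x ^ (s.re - 1) * (1 - x) ^ (w - 1) : ℝ) : ℂ) := by
    rw [betaIntegral, ← intervalIntegral.integral_ofReal]
    refine intervalIntegral.integral_congr_Ioo_of_le zero_le_one fun x hx => ?_
    have h1 : (1 : ℂ) - x = ((1 - x : ℝ) : ℂ) := by push_cast; ring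
    rw [h1]
    push_cast
    rw [ofReal_cpow hx.1.le, ← ofReal_one, ← ofReal_sub, ofReal_cpow (sub_pos.2 hx.2).le]
    push_cast
    rfl
  have h2 : ‖betaIntegral s w‖ ≤ ∫ x in (0 : ℝ)..1, x ^ (s.re - 1) * (1 - x) ^ (w - 1) := by
    refine (intervalIntegral.norm_integral_le_integral_norm zero_le_one).trans_eq ?_
    exact intervalIntegral.integral_congr_Ioo_of_le zero_le_one fun x hx => key x hx
  rw [e, norm_real]
  exact h2.trans (le_abs_self _)

/-- Since `Γ(s) Γ(w) = Γ(s+w) B(s, w)` and `|B(s, w)| ≤ B(Re s, w)`, the ratio `|Γ(s)| / Γ(Re s)`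
does not decrease as `s` moves to the right. Strip estimates can thus be read off from a single
vertical line. -/
theorem norm_Gamma_mul_le {s : ℂ} (hs : 0 < s.re) {w : ℝ} (hw : 0 < w) :
    ‖Gamma s‖ * Real.Gamma (s.re + w) ≤ Real.Gamma s.re * ‖Gamma (s + w)‖ := by
  have h1 := congrArg norm (Gamma_mul_Gamma_eq_betaIntegral (s := s) (t := w) hs (by simpa))
  have h2 := congrArg norm (Gamma_mul_Gamma_eq_betaIntegral (s := (s.re : ℂ)) (t := w)
    (by simpa) (by simpa))
  have h3 := norm_betaIntegral_le (s := s) w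
  rw [← ofReal_add] at h2
  simp only [norm_mul, Gamma_ofReal, norm_real, Real.norm_eq_abs] at h1 h2
  rw [abs_of_pos (Real.Gamma_pos_of_pos hs), abs_of_pos (Real.Gamma_pos_of_pos hw),
    abs_of_pos (Real.Gamma_pos_of_pos (add_pos hs hw))] at h2
  rw [abs_of_pos (Real.Gamma_pos_of_pos hw)] at h1
  have hG := Real.Gamma_pos_of_pos hw
  refine le_of_mul_le_mul_right ?_ hG
  calc ‖Gamma s‖ * Real.Gamma (s.re + w) * Real.Gamma w
      = Real.Gamma (s.re + w) * (‖Gamma s‖ * Real.Gamma w) := by ring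
    _ = Real.Gamma (s.re + w) * (‖Gamma (s + w)‖ * ‖betaIntegral s w‖) := by rw [h1]
    _ ≤ Real.Gamma (s.re + w) * (‖Gamma (s + w)‖ * ‖betaIntegral (s.re : ℂ) w‖) := by
        gcongr
    _ = ‖Gamma (s + w)‖ * (Real.Gamma (s.re + w) * ‖betaIntegral (s.re : ℂ) w‖) := by ring
    _ = Real.Gamma s.re * ‖Gamma (s + w)‖ * Real.Gamma w := by rw [← h2]; ring

theorem Gamma_half_mul_Gamma_half (z : ℂ) :
    Gamma (1 / 2 + z) * Gamma (1 / 2 - z) = Real.pi / cos (Real.pi * z) := by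
  have := Gamma_mul_Gamma_one_sub (1 / 2 + z)
  rw [show (1 : ℂ) - (1 / 2 + z) = 1 / 2 - z by ring,
    show (Real.pi : ℂ) * (1 / 2 + z) = Real.pi * z + Real.pi / 2 by ring, sin_add_pi_div_two]
    at this
  exact this

/-- On the line `Re = 1/2` the reflection `z ↦ 1 - z` is complex conjugation, so the reflection
formula gives the modulus exactly. -/
theorem norm_Gamma_half_sq (t : ℝ) :
    ‖Gamma (1 / 2 + t * I)‖ ^ 2 = Real.pi / Real.cosh (Real.pi * t) := by
  have h := congrArg norm (Gamma_half_mul_Gamma_half (t * I))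
  have hc : (1 / 2 : ℂ) - t * I = (starRingEnd ℂ) (1 / 2 + t * I) := by
    apply Complex.ext <;> simp
  rw [hc, Gamma_conj, norm_mul, norm_conj, ← mul_assoc, cos_mul_I, ← ofReal_mul, ← ofReal_cosh,
    ← ofReal_div, norm_real, Real.norm_eq_abs,
    abs_of_pos (div_pos Real.pi_pos (Real.cosh_pos _))] at h
  rw [sq, h]

theorem cosh_ge_exp_abs (t : ℝ) : Real.exp |t| / 2 ≤ Real.cosh t := by
  rw [← Real.cosh_abs, Real.cosh_eq]
  have := Real.exp_pos (-|t|)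
  linarith

theorem cosh_le_exp_abs (t : ℝ) : Real.cosh t ≤ Real.exp |t| := by
  rw [← Real.cosh_abs, Real.cosh_eq]
  have : Real.exp (-|t|) ≤ Real.exp |t| := Real.exp_le_exp.2 (by linarith [abs_nonneg t])
  linarith

theorem norm_Gamma_half_le (t : ℝ) :
    ‖Gamma (1 / 2 + t * I)‖ ≤ Real.sqrt (2 * Real.pi) * Real.exp (-(Real.pi / 2) * |t|) := by
  have hp := Real.pi_pos
  refine (pow_le_pow_iff_left₀ (by positivity) (by positivity) two_ne_zero).1 ?_
  rw [norm_Gamma_half_sq, mul_pow, Real.sq_sqrt (by positivity), ← Real.exp_nat_mul,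
    div_le_iff₀ (Real.cosh_pos _)]
  have h := cosh_ge_exp_abs (Real.pi * t)
  rw [abs_mul, abs_of_pos hp] at h
  calc Real.pi = 2 * Real.pi * Real.exp (-(Real.pi * |t|)) * (Real.exp (Real.pi * |t|) / 2) := by
        rw [Real.exp_neg]; field_simp
    _ ≤ 2 * Real.pi * Real.exp (-(Real.pi * |t|)) * Real.cosh (Real.pi * t) := by gcongr
    _ = _ := by congr 3; push_cast; ring

theorem norm_Gamma_half_ge (t : ℝ) :
    Real.sqrt Real.pi * Real.exp (-(Real.pi / 2) * |t|) ≤ ‖Gamma (1 / 2 + t * I)‖ := by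
  have hp := Real.pi_pos
  refine (pow_le_pow_iff_left₀ (by positivity) (by positivity) two_ne_zero).1 ?_
  rw [norm_Gamma_half_sq, mul_pow, Real.sq_sqrt (by positivity), ← Real.exp_nat_mul,
    le_div_iff₀ (Real.cosh_pos _)]
  have h := cosh_le_exp_abs (Real.pi * t)
  rw [abs_mul, abs_of_pos hp] at h
  calc _ ≤ Real.pi * Real.exp ((2 : ℕ) * (-(Real.pi / 2) * |t|)) * Real.exp (Real.pi * |t|) := by
        gcongr
    _ = Real.pi := by
        rw [mul_assoc, ← Real.exp_add]
        have : ((2 : ℕ) : ℝ) * (-(Real.pi / 2) * |t|) + Real.pi * |t| = 0 := by push_cast; ring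
        rw [this, Real.exp_zero, mul_one]

theorem exists_Gamma_bounds {p q : ℝ} (hp : 0 < p) (hpq : p ≤ q) :
    ∃ m M : ℝ, 0 < m ∧ ∀ x, p ≤ x → x ≤ q → m ≤ Real.Gamma x ∧ Real.Gamma x ≤ M := by
  have hc : ContinuousOn Real.Gamma (Set.Icc p q) := fun x hx =>
    (Real.differentiableAt_Gamma fun n => by
      have h1 : 0 < x := hp.trans_le hx.1
      have h2 : (0 : ℝ) ≤ n := n.cast_nonneg
      linarith).continuousAt.continuousWithinAt
  obtain ⟨u, hu, hmin⟩ := isCompact_Icc.exists_isMinOn (Set.nonempty_Icc.2 hpq) hc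
  obtain ⟨v, hv, hmax⟩ := isCompact_Icc.exists_isMaxOn (Set.nonempty_Icc.2 hpq) hc
  exact ⟨Real.Gamma u, Real.Gamma v, Real.Gamma_pos_of_pos (hp.trans_le hu.1),
    fun x h1 h2 => ⟨hmin ⟨h1, h2⟩, hmax ⟨h1, h2⟩⟩⟩

theorem pow_le_mul_exp (A : ℝ) (hA : 0 ≤ A) (n : ℕ) {δ : ℝ} (hδ : 0 < δ) :
    ∃ C : ℝ, 0 ≤ C ∧ ∀ t : ℝ, 0 ≤ t → (A + t) ^ n ≤ C * Real.exp (δ * t) := by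
  refine ⟨n.factorial / δ ^ n * Real.exp (δ * A), by positivity, fun t ht => ?_⟩
  have h := Real.pow_div_factorial_le_exp (δ * (A + t)) (by positivity) n
  rw [div_le_iff₀ (by positivity), mul_pow] at h
  rw [mul_assoc, ← Real.exp_add, ← mul_add, div_mul_eq_mul_div, le_div_iff₀ (by positivity)]
  linarith

/-- The comparison line `Re = N + 1/2` lies to the right of the strip and is reached from `Re = 1/2`
by `N` functional equations. Their polynomial factor costs `π/10` of the exact rate `π/2`. The
remaining `2π/5` is enough: six Gamma factors give `12π/5`, more than the growth rate `2π` of the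
sine in `dualHahn`. -/
theorem norm_Gamma_le_strip {p : ℝ} (q : ℝ) (hp : 0 < p) :
    ∃ C : ℝ, 0 ≤ C ∧ ∀ z : ℂ, p ≤ z.re → z.re ≤ q →
      ‖Gamma z‖ ≤ C * Real.exp (-(2 * Real.pi / 5) * |z.im|) := by
  rcases lt_or_ge q p with hqp | hpq
  · exact ⟨0, le_rfl, fun z h1 h2 => absurd (h1.trans h2) (not_le.2 hqp)⟩
  obtain ⟨N, hN⟩ := exists_nat_gt q
  obtain ⟨m, M, hm, hmM⟩ := exists_Gamma_bounds hp hpq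
  have hM : 0 < M := hm.trans_le ((hmM p le_rfl hpq).1.trans (hmM p le_rfl hpq).2)
  have hq : 0 < q := hp.trans_le hpq
  have hshift : ∀ (n : ℕ) (t : ℝ), ‖Gamma (1 / 2 + n + t * I)‖ ≤
      ((n + 1 : ℝ) + |t|) ^ n * ‖Gamma (1 / 2 + t * I)‖ := by
    intro n t
    induction n with
    | zero => simp
    | succ n ih =>
      have hne : (1 / 2 + n + t * I : ℂ) ≠ 0 := by
        intro e
        have := congrArg re e
        simp at this
        have h2 : (0 : ℝ) ≤ n := n.cast_nonneg
        linarith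
      have e : (1 / 2 + ((n + 1 : ℕ) : ℂ) + t * I) = (1 / 2 + n + t * I) + 1 := by push_cast; ring
      have hb : ‖(1 / 2 + n + t * I : ℂ)‖ ≤ (n + 1 + 1) + |t| := by
        refine (norm_add_le _ _).trans ?_
        have h1 : ‖(1 / 2 + n : ℂ)‖ = 1 / 2 + n := by
          rw [show (1 / 2 + n : ℂ) = ((1 / 2 + n : ℝ) : ℂ) by push_cast; ring, norm_real,
            Real.norm_eq_abs, abs_of_pos (by positivity)]
        rw [h1]
        simp
        linarith
      rw [e, Gamma_add_one _ hne, norm_mul, pow_succ']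
      push_cast
      rw [mul_assoc]
      refine mul_le_mul hb (ih.trans ?_) (norm_nonneg _) (by positivity)
      gcongr
      linarith
  obtain ⟨D, hD, hDb⟩ := pow_le_mul_exp (N + 1) (by positivity) N
    (show 0 < Real.pi / 10 by positivity)
  have hGN : 0 < Real.Gamma (1 / 2 + N) := Real.Gamma_pos_of_pos (by positivity)
  refine ⟨M / Real.Gamma (1 / 2 + N) * (D * Real.sqrt (2 * Real.pi)), by positivity,
    fun z h1 h2 => ?_⟩
  have hz : 0 < z.re := hp.trans_le h1
  have hw : 0 < 1 / 2 + N - z.re := by linarith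
  have h := norm_Gamma_mul_le hz hw
  rw [show z.re + (1 / 2 + N - z.re) = 1 / 2 + N by ring,
    show z + ((1 / 2 + N - z.re : ℝ) : ℂ) = 1 / 2 + N + z.im * I by
      apply Complex.ext <;> simp] at h
  rw [← le_div_iff₀ hGN] at h
  calc ‖Gamma z‖ ≤ Real.Gamma z.re * ‖Gamma (1 / 2 + N + z.im * I)‖ / Real.Gamma (1 / 2 + N) := h
    _ ≤ M * ((D * Real.exp (Real.pi / 10 * |z.im|)) *
          (Real.sqrt (2 * Real.pi) * Real.exp (-(Real.pi / 2) * |z.im|)))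
          / Real.Gamma (1 / 2 + N) := by
        gcongr
        · exact (hmM _ h1 h2).2
        · refine (hshift N z.im).trans ?_
          exact mul_le_mul (hDb _ (abs_nonneg _)) (norm_Gamma_half_le _) (norm_nonneg _)
            (by positivity)
    _ = M / Real.Gamma (1 / 2 + N) * (D * Real.sqrt (2 * Real.pi)) *
          (Real.exp (Real.pi / 10 * |z.im|) * Real.exp (-(Real.pi / 2) * |z.im|)) := by ring
    _ = _ := by rw [← Real.exp_add]; congr 2; ring

/-- The line `Re = 1/2` now lies to the left of the strip, so the comparison is direct and the rate
`π/2` is kept without loss. This controls the denominators of the periodic ratio. -/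
theorem norm_Gamma_ge_strip {p : ℝ} (q : ℝ) (hp : 1 / 2 < p) :
    ∃ c : ℝ, 0 < c ∧ ∀ z : ℂ, p ≤ z.re → z.re ≤ q →
      c * Real.exp (-(Real.pi / 2) * |z.im|) ≤ ‖Gamma z‖ := by
  rcases lt_or_ge q p with hqp | hpq
  · exact ⟨1, one_pos, fun z h1 h2 => absurd (h1.trans h2) (not_le.2 hqp)⟩
  obtain ⟨m, M, hm, hmM⟩ := exists_Gamma_bounds (by linarith : 0 < p) hpq
  have hG : 0 < Real.Gamma (1 / 2) := Real.Gamma_pos_of_pos (by norm_num)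
  have hpi := Real.pi_pos
  refine ⟨Real.sqrt Real.pi * m / Real.Gamma (1 / 2), by positivity, fun z h1 h2 => ?_⟩
  have h := norm_Gamma_mul_le (s := 1 / 2 + z.im * I) (w := z.re - 1 / 2) (by simp)
    (by linarith)
  have hre : (1 / 2 + z.im * I : ℂ).re = 1 / 2 := by simp
  rw [hre, show (1 : ℝ) / 2 + (z.re - 1 / 2) = z.re by ring,
    show (1 / 2 + z.im * I : ℂ) + ((z.re - 1 / 2 : ℝ) : ℂ) = z by
      apply Complex.ext <;> simp] at h
  rw [div_mul_eq_mul_div, div_le_iff₀ hG, mul_comm ‖Gamma z‖]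
  refine le_trans ?_ h
  calc Real.sqrt Real.pi * m * Real.exp (-(Real.pi / 2) * |z.im|)
      = (Real.sqrt Real.pi * Real.exp (-(Real.pi / 2) * |z.im|)) * m := by ring
    _ ≤ _ := mul_le_mul (norm_Gamma_half_ge _) (hmM _ h1 h2).1 hm.le (norm_nonneg _)

/-! ### Shifting vertical contours -/

theorem integrable_exp_neg_mul_abs {δ : ℝ} (hδ : 0 < δ) :
    Integrable fun t : ℝ => Real.exp (-δ * |t|) := by
  have h1 : IntegrableOn (fun t : ℝ => Real.exp (-δ * |t|)) (Set.Ioi 0) :=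
    (integrableOn_exp_mul_Ioi (neg_lt_zero.2 hδ) 0).congr_fun
      (fun t ht => by simp only [abs_of_pos (Set.mem_Ioi.1 ht)]) measurableSet_Ioi
  have h2 : IntegrableOn (fun t : ℝ => Real.exp (-δ * |t|)) (Set.Iic 0) :=
    (integrableOn_exp_mul_Iic hδ 0).congr_fun
      (fun t ht => by simp only [abs_of_nonpos (Set.mem_Iic.1 ht), neg_mul_neg]) measurableSet_Iic
  rw [← integrableOn_univ, ← Set.Iic_union_Ioi (a := (0 : ℝ))]
  exact h2.union h1

theorem integrable_vertical {f : ℂ → ℂ} {σ C δ : ℝ} (hδ : 0 < δ)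
    (hf : ∀ t : ℝ, ContinuousAt f (σ + t * I))
    (hb : ∀ t : ℝ, ‖f (σ + t * I)‖ ≤ C * Real.exp (-δ * |t|)) :
    Integrable fun t : ℝ => f (σ + t * I) := by
  refine ((integrable_exp_neg_mul_abs hδ).const_mul C).mono' ?_ (Eventually.of_forall hb)
  refine Continuous.aestronglyMeasurable ?_
  refine continuous_iff_continuousAt.2 fun t => ?_
  exact ContinuousAt.comp (f := fun t : ℝ => (σ + t * I : ℂ)) (hf t) (by fun_prop)

/-- Cauchy's theorem on rectangles with `|Im z| ≤ T`: the horizontal sides are `O(exp(-δ T))`. -/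
theorem integral_vertical_eq {f : ℂ → ℂ} {σ₁ σ₂ C δ : ℝ} (hσ : σ₁ ≤ σ₂) (hδ : 0 < δ)
    (hf : ∀ z : ℂ, σ₁ ≤ z.re → z.re ≤ σ₂ → DifferentiableAt ℂ f z)
    (hb : ∀ z : ℂ, σ₁ ≤ z.re → z.re ≤ σ₂ → ‖f z‖ ≤ C * Real.exp (-δ * |z.im|)) :
    ∫ t : ℝ, f (σ₁ + t * I) = ∫ t : ℝ, f (σ₂ + t * I) := by
  have hint : ∀ σ, σ₁ ≤ σ → σ ≤ σ₂ → Integrable fun t : ℝ => f (σ + t * I) := fun σ h1 h2 =>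
    integrable_vertical hδ (fun t => (hf _ (by simpa) (by simpa)).continuousAt)
      (fun t => by simpa using hb (σ + t * I) (by simpa) (by simpa))
  have lim : ∀ σ, σ₁ ≤ σ → σ ≤ σ₂ → Tendsto (fun T : ℝ => ∫ t in (-T)..T, f (σ + t * I)) atTop
      (𝓝 (∫ t : ℝ, f (σ + t * I))) := fun σ h1 h2 =>
    intervalIntegral_tendsto_integral (hint σ h1 h2) tendsto_neg_atTop_atBot tendsto_id
  have h0 : Tendsto (fun T : ℝ => 2 * (C * Real.exp (-δ * T) * |σ₂ - σ₁|)) atTop (𝓝 0) := by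
    have : Tendsto (fun T : ℝ => Real.exp (-δ * T)) atTop (𝓝 0) :=
      Real.tendsto_exp_atBot.comp (tendsto_id.const_mul_atTop_of_neg (neg_lt_zero.2 hδ))
    simpa using ((this.const_mul C).mul_const |σ₂ - σ₁|).const_mul 2
  have hd := (lim σ₂ hσ le_rfl).sub (lim σ₁ le_rfl hσ)
  have hz : Tendsto (fun T : ℝ => (∫ t in (-T)..T, f (σ₂ + t * I)) -
      ∫ t in (-T)..T, f (σ₁ + t * I)) atTop (𝓝 0) := by
    refine squeeze_zero_norm' ?_ h0
    filter_upwards [eventually_ge_atTop 0] with T hT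
    have hrect := integral_boundary_rect_eq_zero_of_differentiableOn f (σ₁ + (-T : ℝ) * I)
      (σ₂ + T * I) (fun z hz => by
        rw [mem_reProdIm] at hz
        have h1 : (σ₁ + (-T : ℝ) * I : ℂ).re = σ₁ := by simp
        have h2 : (σ₂ + T * I : ℂ).re = σ₂ := by simp
        rw [h1, h2, Set.uIcc_of_le hσ] at hz
        exact (hf z hz.1.1 hz.1.2).differentiableWithinAt)
    have e1 : (σ₁ + (-T : ℝ) * I : ℂ).re = σ₁ := by simp
    have e2 : (σ₂ + T * I : ℂ).re = σ₂ := by simp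
    have e3 : (σ₁ + (-T : ℝ) * I : ℂ).im = -T := by simp
    have e4 : (σ₂ + T * I : ℂ).im = T := by simp
    rw [e1, e2, e3, e4] at hrect
    have hor : ∀ τ : ℝ, |τ| = T → ‖∫ x in σ₁..σ₂, f (x + τ * I)‖ ≤
        C * Real.exp (-δ * T) * |σ₂ - σ₁| := by
      intro τ hτ
      refine intervalIntegral.norm_integral_le_of_norm_le_const fun x hx => ?_
      rw [Set.uIoc_of_le hσ] at hx
      have := hb (x + τ * I) (by simpa using hx.1.le) (by simpa using hx.2)
      simpa [hτ] using this
    have n1 := hor (-T) (by rw [abs_neg, abs_of_nonneg hT])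
    have n2 := hor T (abs_of_nonneg hT)
    have : ((∫ t in (-T)..T, f (σ₂ + t * I)) - ∫ t in (-T)..T, f (σ₁ + t * I)) =
        I * ((∫ x in σ₁..σ₂, f (x + (-T : ℝ) * I)) - ∫ x in σ₁..σ₂, f (x + T * I)) := by
      simp only [smul_eq_mul] at hrect
      linear_combination (-I) * hrect + ((∫ t in (-T)..T, f (σ₂ + t * I)) -
        ∫ t in (-T)..T, f (σ₁ + t * I)) * I_mul_I
    rw [this, norm_mul, norm_I, one_mul]
    refine (norm_sub_le _ _).trans ?_
    linarith
  have := tendsto_nhds_unique hd hz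
  exact (sub_eq_zero.1 this).symm

/-! ### The continuous dual Hahn integrand -/

/-- The product `Γ(a + z) Γ(a - z)`. -/
noncomputable def gammaPair (a z : ℂ) : ℂ := Gamma (a + z) * Gamma (a - z)

/-- Up to a constant factor, the continuous dual Hahn weight
`Γ(a ± z) Γ(b ± z) Γ(c ± z) / Γ(± 2z)`. -/
noncomputable def dualHahn (a b c z : ℂ) : ℂ :=
  z * sin (2 * Real.pi * z) * (gammaPair a z * gammaPair b z * gammaPair c z)

theorem dualHahn_swap_left (a b c z : ℂ) : dualHahn a b c z = dualHahn b a c z := by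
  unfold dualHahn; ring

theorem dualHahn_swap_right (a b c z : ℂ) : dualHahn a b c z = dualHahn a c b z := by
  unfold dualHahn; ring

theorem ne_zero_of_re_pos {z : ℂ} (h : 0 < z.re) : z ≠ 0 := by
  rintro rfl; simp at h

theorem differentiableAt_Gamma_of_re_pos {z : ℂ} (h : 0 < z.re) : DifferentiableAt ℂ Gamma z :=
  differentiableAt_Gamma z fun n e => by
    have := congrArg re e
    simp at this
    have h2 : (0 : ℝ) ≤ n := n.cast_nonneg
    linarith

theorem abs_re_lt_iff {a z : ℂ} : |z.re| < a.re ↔ 0 < (a + z).re ∧ 0 < (a - z).re := by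
  rw [abs_lt, add_re, sub_re]
  constructor <;> rintro ⟨h1, h2⟩ <;> constructor <;> linarith

theorem differentiableAt_gammaPair {a z : ℂ} (h : |z.re| < a.re) :
    DifferentiableAt ℂ (gammaPair a) z := by
  rw [abs_re_lt_iff] at h
  have h1 : DifferentiableAt ℂ (fun w => Gamma (a + w)) z :=
    DifferentiableAt.comp z (differentiableAt_Gamma_of_re_pos h.1) (by fun_prop)
  have h2 : DifferentiableAt ℂ (fun w => Gamma (a - w)) z :=
    DifferentiableAt.comp z (differentiableAt_Gamma_of_re_pos h.2) (by fun_prop)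
  exact h1.mul h2

theorem differentiableAt_dualHahn {a b c z : ℂ} (ha : |z.re| < a.re) (hb : |z.re| < b.re)
    (hc : |z.re| < c.re) : DifferentiableAt ℂ (dualHahn a b c) z := by
  have h1 := differentiableAt_gammaPair ha
  have h2 := differentiableAt_gammaPair hb
  have h3 := differentiableAt_gammaPair hc
  have h0 : DifferentiableAt ℂ (fun w : ℂ => w * sin (2 * Real.pi * w)) z := by fun_prop
  exact h0.mul ((h1.mul h2).mul h3)

theorem gammaPair_add_one {a z : ℂ} (h : |z.re| < a.re) :
    gammaPair (a + 1) z = (a ^ 2 - z ^ 2) * gammaPair a z := by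
  rw [abs_re_lt_iff] at h
  unfold gammaPair
  rw [show a + 1 + z = a + z + 1 by ring, show a + 1 - z = a - z + 1 by ring,
    Gamma_add_one _ (ne_zero_of_re_pos h.1), Gamma_add_one _ (ne_zero_of_re_pos h.2)]
  ring

/-- Raising `a` and moving `z` by half a unit each leaves one Gamma argument fixed and raises the
other by one, so just one linear factor appears. -/
theorem gammaPair_shift_right {a z : ℂ} (h : |z.re| < a.re) :
    gammaPair (a + 1 / 2) (1 / 2 + z) = (a + z) * gammaPair a z := by
  rw [abs_re_lt_iff] at h
  unfold gammaPair
  rw [show a + 1 / 2 + (1 / 2 + z) = a + z + 1 by ring,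
    show a + 1 / 2 - (1 / 2 + z) = a - z by ring, Gamma_add_one _ (ne_zero_of_re_pos h.1)]
  ring

theorem gammaPair_shift_left {a z : ℂ} (h : |z.re| < a.re) :
    gammaPair (a + 1 / 2) (-(1 / 2) + z) = (a - z) * gammaPair a z := by
  rw [abs_re_lt_iff] at h
  unfold gammaPair
  rw [show a + 1 / 2 + (-(1 / 2) + z) = a + z by ring,
    show a + 1 / 2 - (-(1 / 2) + z) = a - z + 1 by ring, Gamma_add_one _ (ne_zero_of_re_pos h.2)]
  ring

/-- The bound is uniform in `Im a`, because `|Im(a+z)| + |Im(a-z)| ≥ 2 |Im z|`. This uniformity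
later bounds the integral on whole vertical strips of the parameter. -/
theorem norm_gammaPair_le {p : ℝ} (q : ℝ) (hp : 0 < p) :
    ∃ C : ℝ, 0 ≤ C ∧ ∀ a z : ℂ, p + |z.re| ≤ a.re → a.re + |z.re| ≤ q →
      ‖gammaPair a z‖ ≤ C * Real.exp (-(4 * Real.pi / 5) * |z.im|) := by
  obtain ⟨C, hC, h⟩ := norm_Gamma_le_strip q hp
  refine ⟨C * C, by positivity, fun a z h1 h2 => ?_⟩
  have l1 := le_abs_self z.re
  have l2 := neg_abs_le z.re
  have b1 := h (a + z) (by rw [add_re]; linarith) (by rw [add_re]; linarith)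
  have b2 := h (a - z) (by rw [sub_re]; linarith) (by rw [sub_re]; linarith)
  have hi : 2 * |z.im| ≤ |(a + z).im| + |(a - z).im| := by
    have := abs_sub (a + z).im (a - z).im
    rw [show (a + z).im - (a - z).im = 2 * z.im by rw [add_im, sub_im]; ring, abs_mul, abs_two]
      at this
    exact this
  unfold gammaPair
  rw [norm_mul]
  calc _ ≤ (C * Real.exp (-(2 * Real.pi / 5) * |(a + z).im|)) *
        (C * Real.exp (-(2 * Real.pi / 5) * |(a - z).im|)) := by gcongr
    _ = C * C * Real.exp (-(2 * Real.pi / 5) * (|(a + z).im| + |(a - z).im|)) := by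
        rw [mul_add, Real.exp_add]; ring
    _ ≤ _ := by
        gcongr ?_ * Real.exp ?_
        have := Real.pi_pos
        nlinarith

theorem norm_sin_le_exp (z : ℂ) : ‖sin z‖ ≤ Real.exp |z.im| := by
  rw [sin, norm_div, norm_mul, norm_I, mul_one]
  have h1 : ‖exp (-z * I)‖ ≤ Real.exp |z.im| := by
    rw [norm_exp]; simpa using le_abs_self z.im
  have h2 : ‖exp (z * I)‖ ≤ Real.exp |z.im| := by
    rw [norm_exp]; simpa using neg_le_abs z.im
  have h3 := norm_sub_le (exp (-z * I)) (exp (z * I))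
  have h4 : ‖(2 : ℂ)‖ = 2 := by simp
  rw [h4, div_le_iff₀ two_pos]
  linarith

theorem norm_sin_two_pi_mul_le (z : ℂ) :
    ‖sin (2 * Real.pi * z)‖ ≤ Real.exp (2 * Real.pi * |z.im|) := by
  refine (norm_sin_le_exp _).trans_eq ?_
  have : (2 * Real.pi * z : ℂ).im = 2 * Real.pi * z.im := by
    rw [show (2 * Real.pi * z : ℂ) = ((2 * Real.pi : ℝ) : ℂ) * z by push_cast; ring, im_ofReal_mul]
  rw [this, abs_mul, abs_of_pos Real.two_pi_pos]

/-- Three pairs decay at total rate `12π/5` and the sine grows at rate `2π`; the difference is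
`2π/5`. The factor `z` in `dualHahn` uses up half of it. -/
theorem norm_sin_mul_gammaPair_le {p : ℝ} (q : ℝ) (hp : 0 < p) :
    ∃ C : ℝ, 0 ≤ C ∧ ∀ a b c z : ℂ, p + |z.re| ≤ a.re → a.re + |z.re| ≤ q →
      p + |z.re| ≤ b.re → b.re + |z.re| ≤ q → p + |z.re| ≤ c.re → c.re + |z.re| ≤ q →
      ‖sin (2 * Real.pi * z) * (gammaPair a z * gammaPair b z * gammaPair c z)‖ ≤
        C * Real.exp (-(2 * Real.pi / 5) * |z.im|) := by
  obtain ⟨C, hC, h⟩ := norm_gammaPair_le q hp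
  refine ⟨C * C * C, by positivity, fun a b c z a1 a2 b1 b2 c1 c2 => ?_⟩
  simp only [norm_mul]
  calc _ ≤ Real.exp (2 * Real.pi * |z.im|) * ((C * Real.exp (-(4 * Real.pi / 5) * |z.im|)) *
        (C * Real.exp (-(4 * Real.pi / 5) * |z.im|)) *
        (C * Real.exp (-(4 * Real.pi / 5) * |z.im|))) := by
        gcongr
        exacts [norm_sin_two_pi_mul_le z, h a z a1 a2, h b z b1 b2, h c z c1 c2]
    _ = C * C * C * (Real.exp (2 * Real.pi * |z.im|) * Real.exp (-(4 * Real.pi / 5) * |z.im|) *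
          Real.exp (-(4 * Real.pi / 5) * |z.im|) * Real.exp (-(4 * Real.pi / 5) * |z.im|)) := by
        ring
    _ = _ := by
        rw [← Real.exp_add, ← Real.exp_add, ← Real.exp_add]
        congr 2
        ring

theorem norm_dualHahn_le {p : ℝ} (q : ℝ) (hp : 0 < p) :
    ∃ C : ℝ, 0 ≤ C ∧ ∀ a b c z : ℂ, p + |z.re| ≤ a.re → a.re + |z.re| ≤ q →
      p + |z.re| ≤ b.re → b.re + |z.re| ≤ q → p + |z.re| ≤ c.re → c.re + |z.re| ≤ q →
      ‖dualHahn a b c z‖ ≤ C * Real.exp (-(Real.pi / 5) * |z.im|) := by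
  have hpi := Real.pi_pos
  obtain ⟨C, hC, h⟩ := norm_sin_mul_gammaPair_le q hp
  obtain ⟨D, hD, hDb⟩ := pow_le_mul_exp |q| (abs_nonneg q) 1 (show 0 < Real.pi / 5 by positivity)
  refine ⟨D * C, by positivity, fun a b c z a1 a2 b1 b2 c1 c2 => ?_⟩
  have hz : ‖z‖ ≤ |q| + |z.im| := by
    refine (norm_le_abs_re_add_abs_im z).trans ?_
    have := le_abs_self q
    have := abs_nonneg z.re
    linarith
  unfold dualHahn
  rw [mul_assoc, norm_mul]
  calc _ ≤ (D * Real.exp (Real.pi / 5 * |z.im|)) *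
        (C * Real.exp (-(2 * Real.pi / 5) * |z.im|)) := by
        refine mul_le_mul (hz.trans ?_) (h a b c z a1 a2 b1 b2 c1 c2) (norm_nonneg _)
          (by positivity)
        simpa using hDb |z.im| (abs_nonneg _)
    _ = D * C * (Real.exp (Real.pi / 5 * |z.im|) * Real.exp (-(2 * Real.pi / 5) * |z.im|)) := by
        ring
    _ = _ := by rw [← Real.exp_add]; congr 2; ring

/-- The shifted contours of the continuous dual Hahn integral all give the same value. -/
theorem integral_dualHahn_vertical {a b c : ℂ} {δ : ℝ} (ha : |δ| < a.re) (hb : |δ| < b.re)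
    (hc : |δ| < c.re) :
    ∫ t : ℝ, dualHahn a b c (δ + t * I) = ∫ t : ℝ, dualHahn a b c (t * I) := by
  obtain ⟨p, hp, ha', hb', hc'⟩ : ∃ p : ℝ, 0 < p ∧ p + |δ| ≤ a.re ∧ p + |δ| ≤ b.re ∧
      p + |δ| ≤ c.re := by
    refine ⟨min (min a.re b.re) c.re - |δ|, by simp [*], ?_, ?_, ?_⟩ <;> simp
  obtain ⟨C, -, hC⟩ := norm_dualHahn_le (a.re + b.re + c.re + |δ|) hp
  have hδ := abs_nonneg δ
  have key : ∀ σ₁ σ₂ : ℝ, |σ₁| ≤ |δ| → |σ₂| ≤ |δ| → σ₁ ≤ σ₂ →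
      ∫ t : ℝ, dualHahn a b c (σ₁ + t * I) = ∫ t : ℝ, dualHahn a b c (σ₂ + t * I) := by
    intro σ₁ σ₂ h1 h2 h12
    have hre : ∀ z : ℂ, σ₁ ≤ z.re → z.re ≤ σ₂ → |z.re| ≤ |δ| := fun z hz1 hz2 =>
      abs_le.2 ⟨(abs_le.1 h1).1.trans hz1, hz2.trans (abs_le.1 h2).2⟩
    refine integral_vertical_eq (C := C) h12 (show 0 < Real.pi / 5 by positivity)
      (fun z hz1 hz2 => ?_) (fun z hz1 hz2 => ?_)
    · have := hre z hz1 hz2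
      exact differentiableAt_dualHahn (by linarith) (by linarith) (by linarith)
    · have := hre z hz1 hz2
      apply hC <;> linarith
  rcases le_total 0 δ with h | h
  · simpa using (key 0 δ (by simp) le_rfl h).symm
  · simpa using key δ 0 le_rfl (by simp) h

theorem integrable_dualHahn {a b c : ℂ} (ha : 0 < a.re) (hb : 0 < b.re) (hc : 0 < c.re) :
    Integrable fun t : ℝ => dualHahn a b c (t * I) := by
  obtain ⟨p, hp, ha', hb', hc'⟩ : ∃ p : ℝ, 0 < p ∧ p ≤ a.re ∧ p ≤ b.re ∧ p ≤ c.re :=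
    ⟨min (min a.re b.re) c.re, by simp [*], by simp, by simp, by simp⟩
  obtain ⟨C, -, hC⟩ := norm_dualHahn_le (a.re + b.re + c.re) hp
  have := integrable_vertical (f := dualHahn a b c) (σ := 0) (C := C)
    (show 0 < Real.pi / 5 by positivity)
    (fun t => (differentiableAt_dualHahn (by simpa) (by simpa) (by simpa)).continuousAt)
    (fun t => by
      have := hC a b c ((0 : ℝ) + t * I)
      simp only [ofReal_zero, zero_add] at this ⊢
      simpa using this (by simpa) (by simp; linarith) (by simpa) (by simp; linarith)
        (by simpa) (by simp; linarith))
  simpa using this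

/-! ### The recurrence in one parameter -/

/-- Raising `a` multiplies the weight by `a² - z²`. Replacing this factor by `(a+b)(a+c)` changes
the integrand by half of `g(z + 1/2) - g(z - 1/2)`, which integrates to zero by a contour shift. -/
theorem integral_dualHahn_add_one {a b c : ℂ} (ha : 0 < a.re) (hb : 0 < b.re) (hc : 0 < c.re) :
    ∫ t : ℝ, dualHahn (a + 1) b c (t * I) =
      (a + b) * (a + c) * ∫ t : ℝ, dualHahn a b c (t * I) := by
  -- With parameters raised by `1/2`, `g` is holomorphic on the closed strip `|Re z| ≤ 1/2`.
  set g : ℂ → ℂ := fun z => sin (2 * Real.pi * z) *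
    (gammaPair (a + 1 / 2) z * gammaPair (b + 1 / 2) z * gammaPair (c + 1 / 2) z) with hg
  obtain ⟨p, hp, ha', hb', hc'⟩ : ∃ p : ℝ, 0 < p ∧ p ≤ a.re ∧ p ≤ b.re ∧ p ≤ c.re :=
    ⟨min (min a.re b.re) c.re, by simp [*], by simp, by simp, by simp⟩
  obtain ⟨C, -, hC⟩ := norm_sin_mul_gammaPair_le (a.re + b.re + c.re + 1) hp
  have hδ : 0 < 2 * Real.pi / 5 := by positivity
  have hre : ∀ x : ℂ, (x + 1 / 2).re = x.re + 1 / 2 := fun x => by simp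
  have hd : ∀ z : ℂ, |z.re| ≤ 1 / 2 → DifferentiableAt ℂ g z := by
    intro z hz
    have h1 := differentiableAt_gammaPair (a := a + 1 / 2) (z := z) (by rw [hre]; linarith)
    have h2 := differentiableAt_gammaPair (a := b + 1 / 2) (z := z) (by rw [hre]; linarith)
    have h3 := differentiableAt_gammaPair (a := c + 1 / 2) (z := z) (by rw [hre]; linarith)
    have h0 : DifferentiableAt ℂ (fun w : ℂ => sin (2 * Real.pi * w)) z := by fun_prop
    exact h0.mul ((h1.mul h2).mul h3)
  have hgb : ∀ z : ℂ, |z.re| ≤ 1 / 2 → ‖g z‖ ≤ C * Real.exp (-(2 * Real.pi / 5) * |z.im|) := by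
    intro z hz
    apply hC <;> rw [hre] <;> linarith
  have hshift := integral_vertical_eq (f := g) (σ₁ := -(1 / 2)) (σ₂ := 1 / 2) (C := C)
    (by norm_num) hδ (fun z h1 h2 => hd z (abs_le.2 ⟨h1, h2⟩))
    (fun z h1 h2 => hgb z (abs_le.2 ⟨h1, h2⟩))
  have hint : ∀ σ : ℝ, |σ| ≤ 1 / 2 → Integrable fun t : ℝ => g (σ + t * I) := fun σ hσ =>
    integrable_vertical (C := C) hδ (fun t => (hd _ (by simpa using hσ)).continuousAt)
      (fun t => by simpa using hgb (σ + t * I) (by simpa using hσ))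
  have i1 := hint (1 / 2) (by norm_num [abs_of_pos])
  have i2 := hint (-(1 / 2)) (by norm_num [abs_of_pos])
  -- The sine changes sign under `z ↦ z ± 1/2`, so half the difference of the products
  -- `(a±z)(b±z)(c±z)` enters as `-z (ab + ac + bc + z²)`. Finally `(a+b)(a+c) - (ab + ac + bc + z²)
  -- = a² - z²`.
  have hpt : ∀ t : ℝ, dualHahn (a + 1) b c (t * I) = (a + b) * (a + c) * dualHahn a b c (t * I) +
      1 / 2 * (g ((1 / 2 : ℝ) + t * I) - g ((-(1 / 2) : ℝ) + t * I)) := by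
    intro t
    have za : |(t * I : ℂ).re| < a.re := by simpa
    have zb : |(t * I : ℂ).re| < b.re := by simpa
    have zc : |(t * I : ℂ).re| < c.re := by simpa
    generalize (t * I : ℂ) = z at *
    simp only [hg, dualHahn]
    push_cast
    rw [gammaPair_add_one za, gammaPair_shift_right za, gammaPair_shift_right zb,
      gammaPair_shift_right zc, gammaPair_shift_left za, gammaPair_shift_left zb,
      gammaPair_shift_left zc,
      show (2 * Real.pi * (1 / 2 + z) : ℂ) = 2 * Real.pi * z + Real.pi by ring,
      show (2 * Real.pi * (-(1 / 2) + z) : ℂ) = 2 * Real.pi * z - Real.pi by ring,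
      sin_add_pi, sin_sub_pi]
    ring
  simp only [hpt]
  rw [integral_add, integral_const_mul, integral_const_mul, integral_sub i1 i2, hshift, sub_self,
    mul_zero, add_zero]
  · exact (integrable_dualHahn ha hb hc).const_mul _
  · exact (i1.sub i2).const_mul _

/-! ### Analyticity in one parameter -/

/-- Differentiation under the integral sign. The derivative in the parameter is dominated through
Cauchy's estimate, so no bound on `deriv Gamma` is needed. -/
theorem differentiableAt_integral_dualHahn {a b c : ℂ} (ha : 0 < a.re) (hb : 0 < b.re)
    (hc : 0 < c.re) :
    DifferentiableAt ℂ (fun a => ∫ t : ℝ, dualHahn a b c (t * I)) a := by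
  -- A circle of radius `r` about a point of the `r`-ball at `a` stays within distance `2r` of `a`,
  -- hence in `Re > r`.
  obtain ⟨r, hr, hra⟩ : ∃ r : ℝ, 0 < r ∧ 3 * r = a.re := ⟨a.re / 3, by positivity, by ring⟩
  obtain ⟨p, hp, pr, pb, pc⟩ : ∃ p : ℝ, 0 < p ∧ p ≤ r ∧ p ≤ b.re ∧ p ≤ c.re :=
    ⟨min (min r b.re) c.re, by simp [*], by simp, by simp, by simp⟩
  obtain ⟨C, hC0, hC⟩ := norm_dualHahn_le (a.re + b.re + c.re + 2 * r) hp
  have hball : ∀ w : ℂ, ‖w - a‖ < 2 * r → r < w.re ∧ w.re < a.re + 2 * r := by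
    intro w hw
    have := abs_lt.1 ((abs_re_le_norm (w - a)).trans_lt hw)
    rw [sub_re] at this
    constructor <;> linarith
  have hbd : ∀ w : ℂ, ‖w - a‖ < 2 * r → ∀ t : ℝ,
      ‖dualHahn w b c (t * I)‖ ≤ C * Real.exp (-(Real.pi / 5) * |t|) := by
    intro w hw t
    obtain ⟨h1, h2⟩ := hball w hw
    have := hC w b c (t * I)
    simp only [mul_re, ofReal_re, I_re, mul_zero, ofReal_im, I_im, mul_one, sub_zero, abs_zero,
      add_zero, mul_im] at this
    exact this (by linarith) (by linarith) pb (by linarith) pc (by linarith)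
  set G : ℂ → ℝ → ℂ := fun w t => t * I * sin (2 * Real.pi * (t * I)) *
    ((deriv Gamma (w + t * I) * Gamma (w - t * I) + Gamma (w + t * I) * deriv Gamma (w - t * I)) *
      gammaPair b (t * I) * gammaPair c (t * I)) with hG
  have hderiv : ∀ w : ℂ, 0 < w.re → ∀ t : ℝ,
      HasDerivAt (fun w => dualHahn w b c (t * I)) (G w t) w := by
    intro w hw t
    have d1 : HasDerivAt (fun w : ℂ => Gamma (w + t * I)) (deriv Gamma (w + t * I)) w :=
      (differentiableAt_Gamma_of_re_pos (by simpa)).hasDerivAt.comp_add_const w _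
    have d2 : HasDerivAt (fun w : ℂ => Gamma (w - t * I)) (deriv Gamma (w - t * I)) w :=
      (differentiableAt_Gamma_of_re_pos (by simpa)).hasDerivAt.comp_sub_const w _
    exact (((d1.mul d2).mul_const _).mul_const _).const_mul _
  have hcont : ∀ (w : ℂ), 0 < w.re → Continuous fun t : ℝ => G w t := by
    intro w hw
    have hop : IsOpen {z : ℂ | 0 < z.re} := isOpen_lt continuous_const continuous_re
    have hdd : ∀ z : ℂ, 0 < z.re → ContinuousAt (deriv Gamma) z := fun z hz =>
      ((DifferentiableOn.deriv (fun y hy => (differentiableAt_Gamma_of_re_pos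
        hy).differentiableWithinAt) hop).differentiableAt (hop.mem_nhds hz)).continuousAt
    have k1 : Continuous fun t : ℝ => deriv Gamma (w + t * I) := continuous_iff_continuousAt.2
      fun t => ContinuousAt.comp (f := fun t : ℝ => (w + t * I : ℂ)) (hdd _ (by simpa))
        (by fun_prop)
    have k2 : Continuous fun t : ℝ => deriv Gamma (w - t * I) := continuous_iff_continuousAt.2
      fun t => ContinuousAt.comp (f := fun t : ℝ => (w - t * I : ℂ)) (hdd _ (by simpa))
        (by fun_prop)
    have k3 : ∀ z : ℂ, 0 < z.re → Continuous fun t : ℝ => Gamma (z + t * I) := fun z hz =>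
      continuous_iff_continuousAt.2 fun t =>
        ContinuousAt.comp (f := fun t : ℝ => (z + t * I : ℂ))
          (differentiableAt_Gamma_of_re_pos (by simpa)).continuousAt (by fun_prop)
    have k4 : ∀ z : ℂ, 0 < z.re → Continuous fun t : ℝ => Gamma (z - t * I) := fun z hz =>
      continuous_iff_continuousAt.2 fun t =>
        ContinuousAt.comp (f := fun t : ℝ => (z - t * I : ℂ))
          (differentiableAt_Gamma_of_re_pos (by simpa)).continuousAt (by fun_prop)
    have k0 : Continuous fun t : ℝ => (t * I * sin (2 * Real.pi * (t * I)) : ℂ) := by fun_prop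
    exact k0.mul ((((k1.mul (k4 w hw)).add ((k3 w hw).mul k2)).mul
      ((k3 b hb).mul (k4 b hb))).mul ((k3 c hc).mul (k4 c hc)))
  refine (hasDerivAt_integral_of_dominated_loc_of_deriv_le (F := fun w t => dualHahn w b c (t * I))
    (F' := G) (bound := fun t => C / r * Real.exp (-(Real.pi / 5) * |t|))
    (Metric.ball_mem_nhds a hr) ?_ (integrable_dualHahn ha hb hc)
    (hcont a ha).aestronglyMeasurable ?_ ?_ ?_).2.differentiableAt
  · filter_upwards [Metric.ball_mem_nhds a hr] with w hw
    rw [mem_ball_iff_norm] at hw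
    exact (integrable_dualHahn (hr.trans (hball w (by linarith)).1) hb hc).aestronglyMeasurable
  · refine Eventually.of_forall fun t w hw => ?_
    rw [mem_ball_iff_norm] at hw
    have hin : ∀ y ∈ Metric.closedBall w r, ‖y - a‖ < 2 * r := by
      intro y hy
      rw [mem_closedBall_iff_norm] at hy
      have := norm_add_le (y - w) (w - a)
      rw [sub_add_sub_cancel] at this
      linarith
    have hpos : ∀ y ∈ Metric.closedBall w r, 0 < y.re := fun y hy => hr.trans (hball y (hin y hy)).1
    rw [← (hderiv w (hpos w (Metric.mem_closedBall_self hr.le)) t).deriv, div_mul_eq_mul_div]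
    refine norm_deriv_le_of_forall_mem_sphere_norm_le hr ?_
      fun y hy => hbd y (hin y (Metric.sphere_subset_closedBall hy)) t
    refine DifferentiableOn.diffContOnCl fun y hy => ?_
    rw [closure_ball _ hr.ne'] at hy
    exact (hderiv y (hpos y hy) t).differentiableAt.differentiableWithinAt
  · exact (integrable_exp_neg_mul_abs (by positivity)).const_mul _
  · refine Eventually.of_forall fun t w hw => ?_
    rw [mem_ball_iff_norm] at hw
    exact hderiv w (hr.trans (hball w (by linarith)).1) t

/-! ### Periodic functions of small exponential type -/

/-- A function of period `1` which grows slower than `exp (2π |Im z|)` is constant. -/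
theorem eq_of_periodic_of_norm_le {F : ℂ → ℂ} {C ρ : ℝ} (hρ : ρ < 2 * Real.pi)
    (hd : ∀ z : ℂ, 0 < z.re → DifferentiableAt ℂ F z) (hper : ∀ z : ℂ, 0 < z.re → F (z + 1) = F z)
    (hb : ∀ z : ℂ, 1 ≤ z.re → z.re ≤ 2 → ‖F z‖ ≤ C * Real.exp (ρ * |z.im|)) {z w : ℂ}
    (hz : 0 < z.re) (hw : 0 < w.re) : F z = F w := by
  set e : ℤ → ℂ → ℂ := fun k z => exp (-(2 * Real.pi * I * k * z)) with he
  have heper : ∀ k z, e k (z + 1) = e k z := by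
    intro k z
    simp only [he]
    rw [show -(2 * Real.pi * I * k * (z + 1)) = -(2 * Real.pi * I * k * z) +
      ((-k : ℤ) : ℂ) * (2 * Real.pi * I) by push_cast; ring, exp_add, exp_int_mul_two_pi_mul_I,
      mul_one]
  have henorm : ∀ k z, ‖e k z‖ = Real.exp (2 * Real.pi * k * z.im) := by
    intro k z
    simp only [he]
    rw [norm_exp]
    congr 1
    rw [show -(2 * Real.pi * I * k * z) = ((-(2 * Real.pi * k) : ℝ) : ℂ) * (z * I) by
      push_cast; ring, re_ofReal_mul]
    simp
  -- Fourier coefficients of `F` along a horizontal period at height `τ`, normalized so as not to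
  -- depend on `τ`: in the rectangle between two heights the vertical sides cancel by periodicity.
  set c : ℤ → ℝ → ℂ := fun k τ => ∫ x in (1 : ℝ)..2, F (x + τ * I) * e k (x + τ * I) with hc
  have hconst : ∀ k τ τ', c k τ = c k τ' := by
    intro k τ τ'
    have hrect := integral_boundary_rect_eq_zero_of_differentiableOn (fun z => F z * e k z)
      ((1 : ℝ) + τ * I) ((2 : ℝ) + τ' * I) (fun z hz => by
        rw [mem_reProdIm] at hz
        have h1 : ((1 : ℝ) + τ * I : ℂ).re = 1 := by simp
        have h2 : ((2 : ℝ) + τ' * I : ℂ).re = 2 := by simp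
        rw [h1, h2, Set.uIcc_of_le one_le_two] at hz
        have := hd z (one_pos.trans_le hz.1.1)
        have h3 : DifferentiableAt ℂ (e k) z := by simp only [he]; fun_prop
        exact (this.mul h3).differentiableWithinAt)
    have e1 : ((1 : ℝ) + τ * I : ℂ).re = 1 := by simp
    have e2 : ((2 : ℝ) + τ' * I : ℂ).re = 2 := by simp
    have e3 : ((1 : ℝ) + τ * I : ℂ).im = τ := by simp
    have e4 : ((2 : ℝ) + τ' * I : ℂ).im = τ' := by simp
    rw [e1, e2, e3, e4] at hrect
    have hside : ∀ y : ℝ, F ((2 : ℝ) + y * I) * e k ((2 : ℝ) + y * I) =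
        F ((1 : ℝ) + y * I) * e k ((1 : ℝ) + y * I) := by
      intro y
      rw [show ((2 : ℝ) + y * I : ℂ) = ((1 : ℝ) + y * I) + 1 by push_cast; ring, heper,
        hper _ (by simp)]
    simp only [hside] at hrect
    simp only [hc]
    linear_combination hrect
  have hcb : ∀ k τ, ‖c k τ‖ ≤ C * Real.exp (ρ * |τ| + 2 * Real.pi * k * τ) := by
    intro k τ
    have := intervalIntegral.norm_integral_le_of_norm_le_const (a := (1 : ℝ)) (b := 2)
      (f := fun x : ℝ => F (x + τ * I) * e k (x + τ * I))
      (C := C * Real.exp (ρ * |τ| + 2 * Real.pi * k * τ)) (fun x hx => by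
        rw [Set.uIoc_of_le one_le_two] at hx
        rw [norm_mul, henorm, Real.exp_add, ← mul_assoc]
        have := hb (x + τ * I) (by simpa using hx.1.le) (by simpa using hx.2)
        have h1 : (x + τ * I : ℂ).im = τ := by simp
        rw [h1] at this ⊢
        gcongr)
    norm_num at this
    exact this
  -- Send the height to `+∞` for `k < 0` and to `-∞` for `k > 0`: there `e k` decays at rate at
  -- least `2π`, faster than `F` can grow.
  have hc0 : ∀ k, k ≠ 0 → ∀ τ, c k τ = 0 := by
    intro k hk τ
    have hlim : Tendsto (fun T : ℝ => C * Real.exp ((ρ - 2 * Real.pi) * T)) atTop (𝓝 0) := by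
      have : Tendsto (fun T : ℝ => Real.exp ((ρ - 2 * Real.pi) * T)) atTop (𝓝 0) :=
        Real.tendsto_exp_atBot.comp (tendsto_id.const_mul_atTop_of_neg (sub_neg.2 hρ))
      simpa using this.const_mul C
    have hC : 0 ≤ C := by
      have := (norm_nonneg _).trans (hb 1 (by simp) (by simp))
      simpa using this
    have hle : ∀ T : ℝ, 0 ≤ T → ‖c k τ‖ ≤ C * Real.exp ((ρ - 2 * Real.pi) * T) := by
      intro T hT
      have hpi := Real.pi_pos
      rcases lt_or_gt_of_ne hk with h | h
      · rw [hconst k τ T]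
        refine (hcb k T).trans ?_
        have h' : (k : ℝ) ≤ -1 := by exact_mod_cast Int.le_sub_one_of_lt h
        rw [abs_of_nonneg hT]
        gcongr
        nlinarith [mul_nonneg hpi.le hT]
      · rw [hconst k τ (-T)]
        refine (hcb k (-T)).trans ?_
        have h' : (1 : ℝ) ≤ k := by exact_mod_cast h
        rw [abs_neg, abs_of_nonneg hT]
        gcongr
        nlinarith [mul_nonneg hpi.le hT]
    have := ge_of_tendsto hlim ((eventually_ge_atTop 0).mono hle)
    exact norm_le_zero_iff.1 this
  -- Only the coefficient `k = 0` survives, so the Fourier series is summable and represents `F`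
  -- pointwise on the segment.
  have hline : ∀ z : ℂ, 1 ≤ z.re → z.re < 2 → F z = c 0 0 := by
    intro z h1 h2
    set f : ℝ → ℂ := fun x => F (x + z.im * I) with hf
    have hfc : ContinuousOn f (Set.Icc 1 (1 + 1)) := fun x hx =>
      (ContinuousAt.comp (f := fun x : ℝ => (x + z.im * I : ℂ))
        (hd _ (by simpa using one_pos.trans_le hx.1)).continuousAt
        (by fun_prop)).continuousWithinAt
    have hfe : f 1 = f (1 + 1) := by
      simp only [hf]
      rw [← hper _ (by simp)]
      push_cast
      congr 1
      ring
    have : Fact (0 < (1 : ℝ)) := ⟨one_pos⟩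
    let φ : C(AddCircle (1 : ℝ), ℂ) := ⟨AddCircle.liftIco 1 1 f,
      AddCircle.liftIco_continuous hfe hfc⟩
    have hcoef : ∀ k : ℤ, fourierCoeff φ k = exp (-(2 * Real.pi * k * z.im)) * c k z.im := by
      intro k
      have h3 : fourierCoeff φ k = fourierCoeffOn (lt_add_of_pos_right (1 : ℝ) one_pos) f k :=
        fourierCoeff_liftIco_eq f k
      rw [h3, fourierCoeffOn_eq_integral, add_sub_cancel_left, div_one, one_smul, one_add_one_eq_two,
        ← intervalIntegral.integral_const_mul]
      refine intervalIntegral.integral_congr fun x _ => ?_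
      simp only [fourier_coe_apply, he, hf, smul_eq_mul]
      rw [mul_left_comm, ← exp_add, mul_comm]
      congr 2
      push_cast
      linear_combination (2 * Real.pi * k * z.im) * I_sq
    have hcoef0 : ∀ k : ℤ, k ≠ 0 → fourierCoeff φ k = 0 := fun k hk => by
      rw [hcoef, hc0 k hk, mul_zero]
    have hs : Summable (fourierCoeff φ) :=
      summable_of_ne_finset_zero (s := {0}) fun k hk => hcoef0 k (by simpa using hk)
    have h4 := has_pointwise_sum_fourier_series_of_summable hs (z.re : AddCircle (1 : ℝ))
    have h5 := h4.unique (hasSum_single 0 fun k hk => by rw [hcoef0 k hk, zero_smul])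
    have h6 : φ (z.re : AddCircle (1 : ℝ)) = F z := by
      change AddCircle.liftIco 1 1 f (z.re : AddCircle (1 : ℝ)) = F z
      rw [AddCircle.liftIco_coe_apply ⟨h1, by linarith⟩]
      simp only [hf, re_add_im]
    rw [← h6, h5, hcoef, hconst 0 z.im 0]
    simp
  have hnat : ∀ (n : ℕ) (z : ℂ), 0 < z.re → F (z + n) = F z := by
    intro n z hz
    induction n with
    | zero => simp
    | succ n ih =>
      rw [← ih, ← hper (z + n) (by simp; positivity)]
      push_cast
      rw [add_assoc]
  have hall : ∀ z : ℂ, 0 < z.re → F z = c 0 0 := by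
    intro z hz
    -- The translate `z + 1 - n` has real part in `[1, 2)`.
    obtain ⟨n, hn⟩ : ∃ n : ℕ, n = ⌊z.re⌋₊ := ⟨_, rfl⟩
    have f1 := Nat.floor_le hz.le
    have f2 := Nat.lt_floor_add_one z.re
    rw [← hn] at f1 f2
    have hre : (z + 1 - n).re = z.re + 1 - n := by simp
    rw [← hper z hz, show z + 1 = (z + 1 - n) + n by ring, hnat _ _ (by rw [hre]; linarith)]
    exact hline _ (by rw [hre]; linarith) (by rw [hre]; linarith)
  rw [hall z hz, hall w hw]

/-! ### Evaluation of the continuous dual Hahn integral -/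

theorem gammaPair_half (z : ℂ) : gammaPair (1 / 2) z = Real.pi / cos (Real.pi * z) :=
  Gamma_half_mul_Gamma_half z

theorem gammaPair_one {z : ℂ} (hz : z ≠ 0) : gammaPair 1 z = Real.pi * z / sin (Real.pi * z) := by
  rw [gammaPair, add_comm, Gamma_add_one z hz, mul_assoc, Gamma_mul_Gamma_one_sub]
  ring

theorem integral_inv_cosh : ∫ t : ℝ, (Real.cosh (Real.pi * t))⁻¹ = 1 := by
  have hpi := Real.pi_pos
  have hd : ∀ t : ℝ, HasDerivAt (fun t => 2 / Real.pi * Real.arctan (Real.exp (Real.pi * t)))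
      (Real.cosh (Real.pi * t))⁻¹ t := by
    intro t
    have h1 : HasDerivAt (fun t : ℝ => Real.pi * t) Real.pi t := by
      simpa using (hasDerivAt_id t).const_mul Real.pi
    refine (h1.exp.arctan.const_mul (2 / Real.pi)).congr_deriv ?_
    rw [Real.cosh_eq, Real.exp_neg]
    have := Real.exp_pos (Real.pi * t)
    field_simp
    ring
  have hi : Integrable fun t : ℝ => (Real.cosh (Real.pi * t))⁻¹ := by
    refine ((integrable_exp_neg_mul_abs hpi).const_mul 2).mono'
      (Continuous.aestronglyMeasurable ?_) (Eventually.of_forall fun t => ?_)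
    · exact (by fun_prop : Continuous fun t : ℝ => Real.cosh (Real.pi * t)).inv₀
        fun t => (Real.cosh_pos _).ne'
    · have h := cosh_ge_exp_abs (Real.pi * t)
      rw [abs_mul, abs_of_pos hpi] at h
      rw [Real.norm_eq_abs, abs_of_pos (inv_pos.2 (Real.cosh_pos _)), neg_mul, Real.exp_neg,
        inv_le_comm₀ (Real.cosh_pos _) (by positivity)]
      refine le_trans (le_of_eq ?_) h
      field_simp
  have h0 : Tendsto (fun t => 2 / Real.pi * Real.arctan (Real.exp (Real.pi * t))) atBot
      (𝓝 (2 / Real.pi * 0)) := by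
    refine Tendsto.const_mul _ ?_
    rw [← Real.arctan_zero]
    exact (Real.continuous_arctan.tendsto 0).comp
      (Real.tendsto_exp_atBot.comp (tendsto_id.const_mul_atBot hpi))
  have h1 : Tendsto (fun t => 2 / Real.pi * Real.arctan (Real.exp (Real.pi * t))) atTop
      (𝓝 (2 / Real.pi * (Real.pi / 2))) := by
    refine Tendsto.const_mul _ ?_
    exact (Real.tendsto_arctan_atTop.mono_right nhdsWithin_le_nhds).comp
      (Real.tendsto_exp_atTop.comp (tendsto_id.const_mul_atTop hpi))
  rw [integral_of_hasDerivAt_of_tendsto hd hi h0 h1]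
  field_simp
  ring

theorem integral_gammaPair_half : ∫ t : ℝ, gammaPair (1 / 2) (t * I) = Real.pi := by
  have : ∀ t : ℝ, gammaPair (1 / 2) (t * I) =
      ((Real.pi * (Real.cosh (Real.pi * t))⁻¹ : ℝ) : ℂ) := by
    intro t
    rw [gammaPair_half, ← mul_assoc, cos_mul_I]
    push_cast
    rw [div_eq_mul_inv]
  simp only [this]
  rw [integral_complex_ofReal, integral_const_mul, integral_inv_cosh, mul_one]

/-- With `f(z) = z Γ(1+z) Γ(1-z)`, half of `f(z + 1/2) - f(z - 1/2)` is `(z² + 1/4) Γ(1/2+z)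
Γ(1/2-z)` and integrates to zero, so the second moment is `-1/4` of the mass. -/
theorem integral_sq_mul_gammaPair_half :
    ∫ t : ℝ, (t * I) ^ 2 * gammaPair (1 / 2) (t * I) = -(Real.pi / 4) := by
  have hpi := Real.pi_pos
  obtain ⟨C, hC, hCb⟩ := norm_gammaPair_le (3 / 2) (show (0 : ℝ) < 1 / 2 by norm_num)
  obtain ⟨D, hD, hDb⟩ := pow_le_mul_exp (1 / 2) (by norm_num) 1 (show 0 < Real.pi / 5 by positivity)
  set f : ℂ → ℂ := fun z => z * gammaPair 1 z with hf
  have hδ : 0 < 3 * Real.pi / 5 := by positivity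
  have hd : ∀ z : ℂ, |z.re| ≤ 1 / 2 → DifferentiableAt ℂ f z := fun z hz =>
    differentiableAt_id.mul (differentiableAt_gammaPair (by simp; linarith))
  have hfb : ∀ z : ℂ, |z.re| ≤ 1 / 2 →
      ‖f z‖ ≤ D * C * Real.exp (-(3 * Real.pi / 5) * |z.im|) := by
    intro z hz
    have h1 := hCb 1 z (by simp; linarith) (by simp; linarith)
    have h2 : ‖z‖ ≤ D * Real.exp (Real.pi / 5 * |z.im|) := by
      refine (norm_le_abs_re_add_abs_im z).trans ((add_le_add_left hz _).trans ?_)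
      simpa using hDb |z.im| (abs_nonneg _)
    simp only [hf, norm_mul]
    calc _ ≤ (D * Real.exp (Real.pi / 5 * |z.im|)) *
          (C * Real.exp (-(4 * Real.pi / 5) * |z.im|)) := by gcongr
      _ = D * C * (Real.exp (Real.pi / 5 * |z.im|) * Real.exp (-(4 * Real.pi / 5) * |z.im|)) := by
          ring
      _ = _ := by rw [← Real.exp_add]; congr 2; ring
  have hshift := integral_vertical_eq (f := f) (σ₁ := -(1 / 2)) (σ₂ := 1 / 2) (by norm_num) hδ
    (fun z h1 h2 => hd z (abs_le.2 ⟨h1, h2⟩)) (fun z h1 h2 => hfb z (abs_le.2 ⟨h1, h2⟩))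
  have hint : ∀ σ : ℝ, |σ| ≤ 1 / 2 → Integrable fun t : ℝ => f (σ + t * I) := fun σ hσ =>
    integrable_vertical hδ (fun t => (hd _ (by simpa using hσ)).continuousAt)
      (fun t => by simpa using hfb (σ + t * I) (by simpa using hσ))
  have i1 := hint (1 / 2) (by norm_num [abs_of_pos])
  have i2 := hint (-(1 / 2)) (by norm_num [abs_of_pos])
  -- A non-integrable function has integral `0` by convention, while this integral is `π`.
  have i0 : Integrable fun t : ℝ => gammaPair (1 / 2) (t * I) := by
    by_contra h
    have := integral_gammaPair_half
    rw [integral_undef h] at this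
    exact hpi.ne (by exact_mod_cast this)
  have hpt : ∀ t : ℝ, (t * I) ^ 2 * gammaPair (1 / 2) (t * I) =
      1 / 2 * (f ((1 / 2 : ℝ) + t * I) - f ((-(1 / 2) : ℝ) + t * I)) -
        1 / 4 * gammaPair (1 / 2) (t * I) := by
    intro t
    have hz : |(t * I : ℂ).re| < (1 / 2 : ℂ).re := by simp
    generalize (t * I : ℂ) = z at *
    have h1 := gammaPair_shift_right hz
    have h2 := gammaPair_shift_left hz
    rw [show (1 / 2 + 1 / 2 : ℂ) = 1 by norm_num] at h1 h2
    simp only [hf]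
    push_cast
    rw [h1, h2]
    ring
  have i12 : Integrable fun t : ℝ => f ((1 / 2 : ℝ) + t * I) - f ((-(1 / 2) : ℝ) + t * I) :=
    i1.sub i2
  simp only [hpt]
  rw [integral_sub (i12.const_mul _) (i0.const_mul _), integral_const_mul,
    integral_const_mul, integral_sub i1 i2, hshift, integral_gammaPair_half]
  ring

/-- Here the pairs are `πz / sin πz` and `π / cos πz`. The factor `sin 2πz` cancels the sine and one
cosine, leaving a second moment of `1 / cosh`. -/
theorem integral_dualHahn_base :
    ∫ t : ℝ, dualHahn 1 (1 / 2) (1 / 2) (t * I) = -(Real.pi ^ 3 / 2) := by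
  have hpt : ∀ t : ℝ, dualHahn 1 (1 / 2) (1 / 2) (t * I) =
      2 * Real.pi ^ 2 * ((t * I) ^ 2 * gammaPair (1 / 2) (t * I)) := by
    intro t
    rcases eq_or_ne t 0 with rfl | ht
    · simp [dualHahn]
    have hz : (t * I : ℂ) ≠ 0 := mul_ne_zero (by exact_mod_cast ht) I_ne_zero
    have hs : sin (Real.pi * (t * I)) ≠ 0 := by
      rw [← mul_assoc, sin_mul_I, ← ofReal_mul, ← ofReal_sinh]
      refine mul_ne_zero ?_ I_ne_zero
      rw [ofReal_ne_zero, Ne, Real.sinh_eq_zero]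
      exact mul_ne_zero Real.pi_ne_zero ht
    have hc : cos (Real.pi * (t * I)) ≠ 0 := by
      rw [← mul_assoc, cos_mul_I, ← ofReal_mul, ← ofReal_cosh, ofReal_ne_zero]
      exact (Real.cosh_pos _).ne'
    generalize (t * I : ℂ) = z at *
    rw [dualHahn, gammaPair_one hz, gammaPair_half, mul_assoc (2 : ℂ), sin_two_mul]
    generalize sin (Real.pi * z) = S at *
    generalize cos (Real.pi * z) = K at *
    field_simp
  simp only [hpt]
  rw [integral_const_mul, integral_sq_mul_gammaPair_half]
  ring

/-- The recurrence makes the ratio periodic. On `1 ≤ Re a ≤ 2` the integral is bounded uniformly in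
`Im a`, and the two inverse Gamma factors grow at rate `π/2` each, in total `π < 2π`. -/
theorem integral_dualHahn_ratio {a a' b c : ℂ} (ha : 0 < a.re) (ha' : 0 < a'.re) (hb : 0 < b.re)
    (hc : 0 < c.re) :
    (∫ t : ℝ, dualHahn a b c (t * I)) / (Gamma (a + b) * Gamma (a + c)) =
      (∫ t : ℝ, dualHahn a' b c (t * I)) / (Gamma (a' + b) * Gamma (a' + c)) := by
  have hpi := Real.pi_pos
  have hG : ∀ z d : ℂ, 0 < z.re → 0 < d.re → Gamma (z + d) ≠ 0 := fun z d h1 h2 =>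
    Gamma_ne_zero_of_re_pos (by rw [add_re]; exact add_pos h1 h2)
  have hGd : ∀ z d : ℂ, 0 < z.re → 0 < d.re → DifferentiableAt ℂ (fun w => Gamma (w + d)) z :=
    fun z d h1 h2 => DifferentiableAt.comp z
      (differentiableAt_Gamma_of_re_pos (by rw [add_re]; exact add_pos h1 h2)) (by fun_prop)
  have hlow : ∀ d : ℂ, 0 < d.re → ∃ m : ℝ, 0 < m ∧ ∀ z : ℂ, 1 ≤ z.re → z.re ≤ 2 →
      m * Real.exp (-(Real.pi / 2) * |z.im|) ≤ ‖Gamma (z + d)‖ := by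
    intro d hd
    obtain ⟨m, hm, h⟩ := norm_Gamma_ge_strip (2 + d.re) (show (1 : ℝ) / 2 < 1 by norm_num)
    refine ⟨m * Real.exp (-(Real.pi / 2) * |d.im|), by positivity, fun z h1 h2 => ?_⟩
    refine le_trans ?_ (h (z + d) (by rw [add_re]; linarith) (by rw [add_re]; linarith))
    rw [mul_assoc, ← Real.exp_add, add_im]
    gcongr m * Real.exp ?_
    have := abs_add_le z.im d.im
    nlinarith
  obtain ⟨m, hm, hmb⟩ := hlow b hb
  obtain ⟨n, hn, hnb⟩ := hlow c hc
  obtain ⟨p, hp, p1, pb, pc⟩ : ∃ p : ℝ, 0 < p ∧ p ≤ 1 ∧ p ≤ b.re ∧ p ≤ c.re :=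
    ⟨min (min 1 b.re) c.re, by simp [*], by simp, by simp, by simp⟩
  obtain ⟨C, hC, hCb⟩ := norm_dualHahn_le (2 + b.re + c.re) hp
  set K : ℝ := ∫ t : ℝ, C * Real.exp (-(Real.pi / 5) * |t|) with hK
  have hK0 : 0 ≤ K := integral_nonneg fun t => by positivity
  refine eq_of_periodic_of_norm_le (ρ := Real.pi) (C := K / (m * n))
    (F := fun a => (∫ t : ℝ, dualHahn a b c (t * I)) / (Gamma (a + b) * Gamma (a + c)))
    (by linarith) (fun z hz => ?_) (fun z hz => ?_) (fun z h1 h2 => ?_) ha ha'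
  · exact (differentiableAt_integral_dualHahn hz hb hc).div ((hGd z b hz hb).mul (hGd z c hz hc))
      (mul_ne_zero (hG z b hz hb) (hG z c hz hc))
  · have hzb : z + b ≠ 0 := ne_zero_of_re_pos (by rw [add_re]; exact add_pos hz hb)
    have hzc : z + c ≠ 0 := ne_zero_of_re_pos (by rw [add_re]; exact add_pos hz hc)
    have := hG z b hz hb
    have := hG z c hz hc
    rw [integral_dualHahn_add_one hz hb hc, add_right_comm z 1 b, add_right_comm z 1 c,
      Gamma_add_one _ hzb, Gamma_add_one _ hzc]
    generalize (∫ t : ℝ, dualHahn z b c (t * I)) = J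
    field_simp
  · have hnum : ‖∫ t : ℝ, dualHahn z b c (t * I)‖ ≤ K := by
      refine norm_integral_le_of_norm_le
        ((integrable_exp_neg_mul_abs (by positivity)).const_mul C)
        (Eventually.of_forall fun t => ?_)
      have := hCb z b c (t * I)
      simp only [mul_re, ofReal_re, I_re, mul_zero, ofReal_im, I_im, mul_one, sub_zero, abs_zero,
        add_zero, mul_im] at this
      exact this (by linarith) (by linarith) pb (by linarith) pc (by linarith)
    rw [norm_div, norm_mul]
    calc _ ≤ K / ((m * Real.exp (-(Real.pi / 2) * |z.im|)) *
          (n * Real.exp (-(Real.pi / 2) * |z.im|))) := by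
          gcongr
          exacts [hmb z h1 h2, hnb z h1 h2]
      _ = K / (m * n) * (Real.exp (-(Real.pi / 2) * |z.im| + -(Real.pi / 2) * |z.im|))⁻¹ := by
          rw [Real.exp_add]; field_simp
      _ = _ := by rw [← Real.exp_neg]; congr 2; ring

/-- The continuous dual Hahn integral. -/
theorem integral_dualHahn {a b c : ℂ} (ha : 0 < a.re) (hb : 0 < b.re) (hc : 0 < c.re) :
    ∫ t : ℝ, dualHahn a b c (t * I) =
      -(2 * Real.pi ^ 2) * (Gamma (a + b) * Gamma (a + c) * Gamma (b + c)) := by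
  have h1 : 0 < (1 : ℂ).re := by simp
  have h2 : 0 < (1 / 2 : ℂ).re := by simp
  have hG : ∀ z d : ℂ, 0 < z.re → 0 < d.re → Gamma (z + d) ≠ 0 := fun z d h1 h2 =>
    Gamma_ne_zero_of_re_pos (by rw [add_re]; exact add_pos h1 h2)
  have swap : ∀ a b c : ℂ, ∫ t : ℝ, dualHahn a b c (t * I) = ∫ t : ℝ, dualHahn b a c (t * I) :=
    fun a b c => by simp only [dualHahn_swap_left a b c]
  have swap' : ∀ a b c : ℂ, ∫ t : ℝ, dualHahn a b c (t * I) = ∫ t : ℝ, dualHahn a c b (t * I) :=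
    fun a b c => by simp only [dualHahn_swap_right a b c]
  -- The parameters move one at a time: `a` to `1`, then `b` to `1/2`, then `c` to `1/2`, with
  -- permutations in between.
  have r1 := integral_dualHahn_ratio ha h1 hb hc
  have r2 := integral_dualHahn_ratio hb h2 h1 hc
  have r3 := integral_dualHahn_ratio hc h2 h1 h2
  have e1 : ∫ t : ℝ, dualHahn c 1 (1 / 2) (t * I) = ∫ t : ℝ, dualHahn (1 / 2) 1 c (t * I) := by
    rw [swap, swap', swap]
  have e2 : ∫ t : ℝ, dualHahn (1 / 2) 1 (1 / 2) (t * I) = -(Real.pi ^ 3 / 2) := by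
    rw [swap, integral_dualHahn_base]
  rw [swap 1 b c, add_comm (1 : ℂ) b] at r1
  rw [e2] at r3
  rw [e1] at r3
  have g1 := hG a b ha hb
  have g2 := hG a c ha hc
  have g3 := hG b 1 hb h1
  have g4 := hG b c hb hc
  have g5 := hG 1 c h1 hc
  have g6 := hG (1 / 2) c h2 hc
  have hhalf : Gamma (1 / 2 + 1) = Gamma (1 / 2) / 2 := by
    rw [Gamma_add_one _ (by norm_num)]; ring
  have hsq : Gamma (1 / 2 : ℂ) * Gamma (1 / 2) = Real.pi := by
    have := Gamma_half_mul_Gamma_half 0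
    simpa using this
  have g7 : Gamma (1 / 2 : ℂ) ≠ 0 := Gamma_ne_zero_of_re_pos (by simp)
  rw [show (1 / 2 + 1 / 2 : ℂ) = 1 by norm_num, Gamma_one, mul_one, hhalf, add_comm c 1,
    add_comm c (1 / 2)] at r3
  rw [hhalf] at r2
  rw [div_eq_iff (mul_ne_zero g5 g6)] at r3
  rw [r3, div_eq_iff (mul_ne_zero g3 g4)] at r2
  rw [r2, div_eq_iff (mul_ne_zero g1 g2)] at r1
  rw [r1]
  have hsq' : (Gamma (1 / 2 : ℂ)) ^ 2 = Real.pi := by rw [sq, hsq]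
  have hpi : (Real.pi : ℂ) ≠ 0 := by exact_mod_cast Real.pi_ne_zero
  generalize Gamma (1 / 2 + c) = X at *
  generalize Gamma (1 / 2 : ℂ) = Y at *
  field_simp
  rw [hsq']

/-! ### The Mellin-Barnes integrals for `ħ = 1` -/

/-- The product `∏ⱼ Γ(s - aⱼ)`. -/
noncomputable def gammaProd (a : Fin 3 → ℝ) (s : ℂ) : ℂ := ∏ j, Gamma (s - a j)

/-- The integrand of the double Mellin-Barnes integral. -/
noncomputable def barnesKernel (L : ℝ) (b : Fin 3 → ℝ) (s₁ s₂ : ℂ) : ℂ :=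
  exp (L * (s₁ + s₂)) * (gammaProd b s₁ * gammaProd b s₂) *
    (Gamma (s₁ - s₂) * Gamma (s₂ - s₁))⁻¹

/-- Reflection formula. At the poles the conventions `Γ(-n) = 0` and `0⁻¹ = 0` give the zeros of the
entire right-hand side. -/
theorem inv_Gamma_mul_Gamma_neg (w : ℂ) :
    (Gamma w * Gamma (-w))⁻¹ = -(w * sin (Real.pi * w)) / Real.pi := by
  rcases eq_or_ne w 0 with rfl | hw
  · simp
  have h1 := Gamma_mul_Gamma_one_sub w
  rw [sub_eq_neg_add, Gamma_add_one _ (neg_ne_zero.2 hw)] at h1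
  have h2 : Gamma w * Gamma (-w) = -(Real.pi / sin (Real.pi * w)) / w := by
    rw [← h1]; field_simp
  rw [h2, inv_div, div_neg, div_div_eq_mul_div, neg_div]

theorem differentiableAt_gammaProd {a : Fin 3 → ℝ} {s : ℂ} (hs : ∀ j, a j < s.re) :
    DifferentiableAt ℂ (gammaProd a) s := by
  have : ∀ j ∈ Finset.univ, DifferentiableAt ℂ (fun s : ℂ => Gamma (s - a j)) s := fun j _ =>
    DifferentiableAt.comp s (differentiableAt_Gamma_of_re_pos (by simpa using hs j)) (by fun_prop)
  exact DifferentiableAt.fun_finsetProd this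

theorem norm_gammaProd_le {a : Fin 3 → ℝ} {p : ℝ} (q : ℝ) (hp : ∀ j, a j < p) :
    ∃ C : ℝ, 0 ≤ C ∧ ∀ s : ℂ, p ≤ s.re → s.re ≤ q →
      ‖gammaProd a s‖ ≤ C * Real.exp (-(6 * Real.pi / 5) * |s.im|) := by
  have h := fun j => norm_Gamma_le_strip (q - a j) (sub_pos.2 (hp j))
  choose C hC hb using h
  refine ⟨∏ j, C j, Finset.prod_nonneg fun j _ => hC j, fun s h1 h2 => ?_⟩
  rw [gammaProd, norm_prod]
  calc _ ≤ ∏ j, C j * Real.exp (-(2 * Real.pi / 5) * |s.im|) := by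
        refine Finset.prod_le_prod (fun j _ => norm_nonneg _) fun j _ => ?_
        have := hb j (s - a j) (by simpa using h1) (by simpa using h2)
        simpa using this
    _ = _ := by
        rw [Finset.prod_mul_distrib, Finset.prod_const, Finset.card_univ, Fintype.card_fin,
          ← Real.exp_nat_mul]
        congr 2
        push_cast
        ring

theorem norm_exp_mul_gammaProd_le {a : Fin 3 → ℝ} {p : ℝ} (L q : ℝ) (hp : ∀ j, a j < p) :
    ∃ C : ℝ, 0 ≤ C ∧ ∀ s : ℂ, p ≤ s.re → s.re ≤ q →
      ‖exp (L * s) * gammaProd a s‖ ≤ C * Real.exp (-(6 * Real.pi / 5) * |s.im|) := by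
  obtain ⟨C, hC, h⟩ := norm_gammaProd_le q hp
  refine ⟨Real.exp (|L| * max |p| |q|) * C, by positivity, fun s h1 h2 => ?_⟩
  have hexp : L * s.re ≤ |L| * max |p| |q| := by
    refine (le_abs_self _).trans ?_
    rw [abs_mul]
    exact mul_le_mul_of_nonneg_left (abs_le_max_abs_abs h1 h2) (abs_nonneg L)
  rw [norm_mul, norm_exp, re_ofReal_mul, mul_assoc]
  exact mul_le_mul (Real.exp_le_exp.2 hexp) (h s h1 h2) (norm_nonneg _) (Real.exp_pos _).le

theorem differentiableAt_exp_mul_gammaProd (L : ℝ) {a : Fin 3 → ℝ} {s : ℂ} (hs : ∀ j, a j < s.re) :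
    DifferentiableAt ℂ (fun s => exp (L * s) * gammaProd a s) s :=
  DifferentiableAt.mul (by fun_prop) (differentiableAt_gammaProd hs)

theorem integrable_exp_mul_gammaProd (L : ℝ) {a : Fin 3 → ℝ} {σ : ℝ} (hσ : ∀ j, a j < σ) :
    Integrable fun t : ℝ => exp (L * (σ + t * I)) * gammaProd a (σ + t * I) := by
  obtain ⟨C, -, hC⟩ := norm_exp_mul_gammaProd_le L σ hσ
  exact integrable_vertical (f := fun s => exp (L * s) * gammaProd a s) (C := C)
    (show 0 < 6 * Real.pi / 5 by positivity)
    (fun t => (differentiableAt_exp_mul_gammaProd L (by simpa using hσ)).continuousAt)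
    (fun t => by simpa using hC (σ + t * I) (by simp) (by simp))

theorem integral_exp_mul_gammaProd_eq (L : ℝ) {a : Fin 3 → ℝ} {σ₁ σ₂ : ℝ} (h1 : ∀ j, a j < σ₁)
    (h2 : ∀ j, a j < σ₂) :
    ∫ t : ℝ, exp (L * (σ₁ + t * I)) * gammaProd a (σ₁ + t * I) =
      ∫ t : ℝ, exp (L * (σ₂ + t * I)) * gammaProd a (σ₂ + t * I) := by
  wlog h : σ₁ ≤ σ₂ generalizing σ₁ σ₂
  · exact (this h2 h1 (le_of_not_ge h)).symm
  obtain ⟨C, -, hC⟩ := norm_exp_mul_gammaProd_le L σ₂ h1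
  exact integral_vertical_eq (f := fun s => exp (L * s) * gammaProd a s) h
    (show 0 < 6 * Real.pi / 5 by positivity)
    (fun s hs1 _ => differentiableAt_exp_mul_gammaProd L fun j => (h1 j).trans_le hs1) hC

/-- In each variable the three Gamma factors decay at rate `6π/5`; the sine costs `π` and the linear
factor `π/10`, so a rate of `π/10` remains. -/
theorem integrable_barnesKernel (L : ℝ) {b : Fin 3 → ℝ} {σ₁ σ₂ : ℝ} (h1 : ∀ j, b j < σ₁)
    (h2 : ∀ j, b j < σ₂) :
    Integrable fun t : ℝ × ℝ => barnesKernel L b (σ₁ + t.1 * I) (σ₂ + t.2 * I) := by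
  have hpi := Real.pi_pos
  obtain ⟨C₁, hC₁, hb₁⟩ := norm_exp_mul_gammaProd_le L σ₁ h1
  obtain ⟨C₂, hC₂, hb₂⟩ := norm_exp_mul_gammaProd_le L σ₂ h2
  obtain ⟨D, hD, hDb⟩ := pow_le_mul_exp |σ₁ - σ₂| (abs_nonneg _) 1
    (show 0 < Real.pi / 10 by positivity)
  have hE : Integrable fun t : ℝ => Real.exp (-(Real.pi / 10) * |t|) :=
    integrable_exp_neg_mul_abs (by positivity)
  have heq : ∀ s₁ s₂ : ℂ, barnesKernel L b s₁ s₂ =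
      (exp (L * s₁) * gammaProd b s₁) * (exp (L * s₂) * gammaProd b s₂) *
        (-((s₁ - s₂) * sin (Real.pi * (s₁ - s₂))) / Real.pi) := by
    intro s₁ s₂
    rw [← inv_Gamma_mul_Gamma_neg, neg_sub, barnesKernel, mul_add, exp_add]
    ring
  refine ((hE.mul_prod hE).const_mul (C₁ * C₂ * D / Real.pi)).mono'
    (Continuous.aestronglyMeasurable ?_) (Eventually.of_forall fun t => ?_)
  · simp only [heq]
    have hc : ∀ σ : ℝ, (∀ j, b j < σ) → Continuous fun t : ℝ => gammaProd b (σ + t * I) :=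
      fun σ hσ => continuous_iff_continuousAt.2 fun t =>
        ContinuousAt.comp (f := fun t : ℝ => (σ + t * I : ℂ))
          (differentiableAt_gammaProd (by simpa using hσ)).continuousAt (by fun_prop)
    have c1 := (hc σ₁ h1).comp (continuous_fst (X := ℝ) (Y := ℝ))
    have c2 := (hc σ₂ h2).comp (continuous_snd (X := ℝ) (Y := ℝ))
    simp only [Function.comp_def] at c1 c2
    fun_prop
  · rw [heq, norm_mul, norm_mul, norm_div, norm_neg, norm_mul _ (sin _), norm_real,
      Real.norm_eq_abs, abs_of_pos hpi]
    have n1 := hb₁ (σ₁ + t.1 * I) (by simp) (by simp)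
    have n2 := hb₂ (σ₂ + t.2 * I) (by simp) (by simp)
    have i1 : (σ₁ + t.1 * I : ℂ).im = t.1 := by simp
    have i2 : (σ₂ + t.2 * I : ℂ).im = t.2 := by simp
    rw [i1] at n1
    rw [i2] at n2
    set w : ℂ := σ₁ + t.1 * I - (σ₂ + t.2 * I) with hw
    have wre : w.re = σ₁ - σ₂ := by simp [hw]
    have wim : w.im = t.1 - t.2 := by simp [hw]
    have habs : |w.im| ≤ |t.1| + |t.2| := wim ▸ abs_sub _ _
    have n3 : ‖w‖ ≤ D * Real.exp (Real.pi / 10 * (|t.1| + |t.2|)) := by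
      have := hDb (|t.1| + |t.2|) (by positivity)
      rw [pow_one] at this
      refine (norm_le_abs_re_add_abs_im w).trans (le_trans ?_ this)
      rw [wre]
      gcongr
    have n4 : ‖sin (Real.pi * w)‖ ≤ Real.exp (Real.pi * (|t.1| + |t.2|)) := by
      refine (norm_sin_le_exp _).trans ?_
      rw [im_ofReal_mul, abs_mul, abs_of_pos hpi]
      gcongr
    calc _ ≤ (C₁ * Real.exp (-(6 * Real.pi / 5) * |t.1|)) *
          (C₂ * Real.exp (-(6 * Real.pi / 5) * |t.2|)) *
          (D * Real.exp (Real.pi / 10 * (|t.1| + |t.2|)) *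
            Real.exp (Real.pi * (|t.1| + |t.2|)) / Real.pi) := by
          gcongr
      _ = C₁ * C₂ * D / Real.pi * (Real.exp (-(6 * Real.pi / 5) * |t.1|) *
          Real.exp (-(6 * Real.pi / 5) * |t.2|) * Real.exp (Real.pi / 10 * (|t.1| + |t.2|)) *
            Real.exp (Real.pi * (|t.1| + |t.2|))) := by ring
      _ = _ := by
          simp only [← Real.exp_add]
          congr 2
          ring

theorem barnesKernel_eq_dualHahn (L : ℝ) (b : Fin 3 → ℝ) (s z : ℂ) :
    barnesKernel L b (s / 2 + z) (s / 2 - z) = -(2 / Real.pi) * exp (L * s) *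
      dualHahn (s / 2 - b 0) (s / 2 - b 1) (s / 2 - b 2) z := by
  have e1 : ∀ j, s / 2 + z - b j = s / 2 - b j + z := fun j => by ring
  have e2 : ∀ j, s / 2 - z - b j = s / 2 - b j - z := fun j => by ring
  rw [barnesKernel, show s / 2 - z - (s / 2 + z) = -(s / 2 + z - (s / 2 - z)) by ring,
    inv_Gamma_mul_Gamma_neg, show s / 2 + z + (s / 2 - z) = s by ring,
    show s / 2 + z - (s / 2 - z) = 2 * z by ring,
    show Real.pi * (2 * z) = 2 * Real.pi * z by ring]
  simp only [gammaProd, Fin.prod_univ_three, e1, e2, dualHahn, gammaPair]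
  ring

/-- The inner integral at a fixed sum `s` of the two variables is a dual Hahn integral on the line
`Re z = δ`, half the gap between the contours. The relation `hab` turns its pairwise parameter sums
into `s - aᵢ`, and `4π = (2/π) · 2π²`. -/
theorem integral_barnesKernel_diagonal (L : ℝ) {a b : Fin 3 → ℝ}
    (hab : ∀ i j k : Fin 3, i ≠ j → j ≠ k → i ≠ k → a i = b j + b k) {σ₁ σ₂ : ℝ}
    (h1 : ∀ j, b j < σ₁) (h2 : ∀ j, b j < σ₂) (T : ℝ) :
    ∫ t : ℝ, barnesKernel L b (σ₁ + t * I) (σ₂ + (-t + T : ℝ) * I) =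
      4 * Real.pi * (exp (L * ((σ₁ + σ₂ : ℝ) + T * I)) *
        gammaProd a ((σ₁ + σ₂ : ℝ) + T * I)) := by
  set s : ℂ := (σ₁ + σ₂ : ℝ) + T * I with hs
  set δ : ℝ := (σ₁ - σ₂) / 2 with hδ
  have hpt : ∀ t : ℝ, barnesKernel L b (σ₁ + t * I) (σ₂ + (-t + T : ℝ) * I) =
      -(2 / Real.pi) * exp (L * s) * dualHahn (s / 2 - b 0) (s / 2 - b 1) (s / 2 - b 2)
        (δ + (t - T / 2 : ℝ) * I) := by
    intro t
    rw [← barnesKernel_eq_dualHahn]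
    congr 1
    · rw [hs, hδ]; push_cast; ring
    · rw [hs, hδ]; push_cast; ring
  have hre : ∀ j, (s / 2 - b j : ℂ).re = (σ₁ + σ₂) / 2 - b j := fun j => by
    rw [hs, sub_re, ofReal_re, show (2 : ℂ) = ((2 : ℝ) : ℂ) by push_cast; rfl, div_ofReal_re]
    simp
  have hlt : ∀ j, |δ| < (s / 2 - b j : ℂ).re := by
    intro j
    rw [hre, hδ, abs_lt]
    constructor <;> linarith [h1 j, h2 j]
  have hpos : ∀ j, 0 < (s / 2 - b j : ℂ).re := fun j => (abs_nonneg δ).trans_lt (hlt j)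
  simp only [hpt]
  rw [integral_const_mul, integral_sub_right_eq_self (fun t : ℝ => dualHahn (s / 2 - b 0)
    (s / 2 - b 1) (s / 2 - b 2) (δ + t * I)) (T / 2),
    integral_dualHahn_vertical (hlt 0) (hlt 1) (hlt 2), integral_dualHahn (hpos 0) (hpos 1) (hpos 2)]
  have hpi : (Real.pi : ℂ) ≠ 0 := by exact_mod_cast Real.pi_ne_zero
  have a0 := hab 0 1 2 (by decide) (by decide) (by decide)
  have a1 := hab 1 0 2 (by decide) (by decide) (by decide)
  have a2 := hab 2 0 1 (by decide) (by decide) (by decide)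
  rw [gammaProd, Fin.prod_univ_three, a0, a1, a2]
  push_cast
  rw [show s / 2 - b 0 + (s / 2 - b 1) = s - (b 0 + b 1) by ring,
    show s / 2 - b 0 + (s / 2 - b 2) = s - (b 0 + b 2) by ring,
    show s / 2 - b 1 + (s / 2 - b 2) = s - (b 1 + b 2) by ring]
  field_simp
  ring

theorem integral_barnesKernel (L : ℝ) {a b : Fin 3 → ℝ}
    (hab : ∀ i j k : Fin 3, i ≠ j → j ≠ k → i ≠ k → a i = b j + b k) {σ σ₁ σ₂ : ℝ}
    (h : ∀ j, a j < σ) (h1 : ∀ j, b j < σ₁) (h2 : ∀ j, b j < σ₂) :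
    ∫ t : ℝ × ℝ, barnesKernel L b (σ₁ + t.1 * I) (σ₂ + t.2 * I) =
      4 * Real.pi * ∫ t : ℝ, exp (L * (σ + t * I)) * gammaProd a (σ + t * I) := by
  -- The shear `(t, T) ↦ (t, -t + T)` preserves the measure and makes `T` the imaginary part of the
  -- sum. Fubini then integrates over `t` first.
  have hmp := measurePreserving_prod_neg_add (volume : Measure ℝ) (volume : Measure ℝ)
  have hint := integrable_barnesKernel L h1 h2
  have hint' := hmp.integrable_comp_of_integrable hint
  have hcomp := hmp.integral_comp (MeasurableEquiv.shearAddRight ℝ).symm.measurableEmbedding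
    (fun t : ℝ × ℝ => barnesKernel L b (σ₁ + t.1 * I) (σ₂ + t.2 * I))
  have hsum : ∀ j, a j < σ₁ + σ₂ := by
    intro j
    obtain ⟨k, l, h3, h4, h5⟩ : ∃ k l : Fin 3, j ≠ k ∧ k ≠ l ∧ j ≠ l := by
      revert j; decide
    rw [hab j k l h3 h4 h5]
    exact add_lt_add (h1 k) (h2 l)
  rw [Measure.volume_eq_prod, ← hcomp]
  refine (integral_prod_symm _ hint').trans ?_
  simp only [Function.comp_apply, integral_barnesKernel_diagonal L hab h1 h2]
  rw [integral_const_mul, integral_exp_mul_gammaProd_eq L hsum h]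

/-! ### The matrix elements in rescaled variables -/

/-- The exponent `3 log ħ - x` of the rescaled integrals. -/
noncomputable def rescaledExponent (h x : ℝ) : ℝ := 3 * Real.log h - x

theorem gammaOne_eq {h : ℝ} (hh : 0 < h) (z : ℂ) :
    gammaOne z h = exp (Real.log h * (z / h)) * Gamma (z / h) := by
  have hc : (h : ℂ) ≠ 0 := by exact_mod_cast hh.ne'
  rw [gammaOne, cpow_def_of_ne_zero hc, ofReal_log hh.le]

/-- The three powers of `h` merge with `exp(-γ x / h)` into one exponential in `γ / h`; the part
that depends on `lam` alone becomes a constant prefactor. -/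
theorem exp_mul_prod_gammaOne {h : ℝ} (hh : 0 < h) (lam : Fin 3 → ℝ) (x : ℝ) (γ : ℂ) :
    exp (-γ * x / h) * ∏ j, gammaOne (γ - lam j) h =
      exp (-(Real.log h * ∑ j, lam j / h : ℝ)) *
        (exp (rescaledExponent h x * (γ / h)) * gammaProd (fun j => lam j / h) (γ / h)) := by
  have hc : (h : ℂ) ≠ 0 := by exact_mod_cast hh.ne'
  simp only [gammaOne_eq hh, Finset.prod_mul_distrib, ← exp_sum, gammaProd, ofReal_div, sub_div]
  rw [← mul_assoc, ← mul_assoc, ← exp_add, ← exp_add]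
  congr 2
  rw [Fin.sum_univ_three, Fin.sum_univ_three, rescaledExponent]
  push_cast
  ring

theorem gammaOne_mul_gammaOne_neg {h : ℝ} (hh : 0 < h) (u v : ℂ) :
    gammaOne (u - v) h * gammaOne (v - u) h =
      Gamma (u / h - v / h) * Gamma (v / h - u / h) := by
  rw [gammaOne_eq hh, gammaOne_eq hh, mul_mul_mul_comm, ← exp_add, ← mul_add, ← add_div,
    sub_add_sub_cancel, sub_self, zero_div, mul_zero, exp_zero, one_mul, sub_div, sub_div]

theorem exp_mul_prod_gammaOne_div {h : ℝ} (hh : 0 < h) (lam : Fin 3 → ℝ) (x : ℝ) (γ₁ γ₂ : ℂ) :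
    exp (-(γ₁ + γ₂) * x / h) * (∏ j, (gammaOne (γ₁ - lam j) h * gammaOne (γ₂ - lam j) h)) /
      (gammaOne (γ₁ - γ₂) h * gammaOne (γ₂ - γ₁) h) =
      exp (-(Real.log h * (2 * ∑ j, lam j / h) : ℝ)) *
        barnesKernel (rescaledExponent h x) (fun j => lam j / h) (γ₁ / h) (γ₂ / h) := by
  have e : exp (-(γ₁ + γ₂) * x / h) = exp (-γ₁ * x / h) * exp (-γ₂ * x / h) := by
    rw [← exp_add]; congr 1; ring
  have e' : exp (-(Real.log h * (2 * ∑ j, lam j / h) : ℝ)) =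
      exp (-(Real.log h * ∑ j, lam j / h : ℝ)) * exp (-(Real.log h * ∑ j, lam j / h : ℝ)) := by
    rw [← exp_add]; congr 1; push_cast; ring
  rw [gammaOne_mul_gammaOne_neg hh, Finset.prod_mul_distrib, e, mul_mul_mul_comm,
    exp_mul_prod_gammaOne hh, exp_mul_prod_gammaOne hh, e', barnesKernel, mul_add, exp_add,
    div_eq_mul_inv]
  ring

theorem line_div (h ε t : ℝ) :
    (ε + t * I : ℂ) / h = (ε / h : ℝ) + (t / h : ℝ) * I := by
  push_cast
  ring

theorem whittaker13_eq_rescaled {h : ℝ} (hh : 0 < h) (c : ℂ) (lam : Fin 3 → ℝ) (ε x : ℝ) :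
    whittaker13 c h lam ε x = c * I * (h * exp (-(Real.log h * ∑ j, lam j / h : ℝ)) *
      ∫ t : ℝ, exp (rescaledExponent h x * ((ε / h : ℝ) + t * I)) *
        gammaProd (fun j => lam j / h) ((ε / h : ℝ) + t * I)) := by
  rw [whittaker13_eq hh]
  simp only [exp_mul_prod_gammaOne hh, line_div]
  rw [integral_const_mul, Measure.integral_comp_div (fun t : ℝ => exp (rescaledExponent h x *
    ((ε / h : ℝ) + t * I)) * gammaProd (fun j => lam j / h) ((ε / h : ℝ) + t * I)) h,
    abs_of_pos hh, real_smul]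
  ring

theorem whittaker23_eq_rescaled {h : ℝ} (hh : 0 < h) (c : ℂ) (lam : Fin 3 → ℝ) (ε₁ ε₂ x : ℝ) :
    whittaker23 c h lam ε₁ ε₂ x = c * I ^ 2 *
      (h ^ 2 * exp (-(Real.log h * (2 * ∑ j, lam j / h) : ℝ)) *
        ∫ t : ℝ × ℝ, barnesKernel (rescaledExponent h x) (fun j => lam j / h)
          ((ε₁ / h : ℝ) + t.1 * I) ((ε₂ / h : ℝ) + t.2 * I)) := by
  have hs := Measure.integral_comp_smul (volume : Measure (ℝ × ℝ)) (fun t : ℝ × ℝ =>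
    barnesKernel (rescaledExponent h x) (fun j => lam j / h)
      ((ε₁ / h : ℝ) + t.1 * I) ((ε₂ / h : ℝ) + t.2 * I)) h⁻¹
  have hf : Module.finrank ℝ (ℝ × ℝ) = 2 := by simp
  rw [hf, inv_pow, inv_inv, abs_of_pos (by positivity), real_smul] at hs
  simp only [Prod.smul_fst, Prod.smul_snd, smul_eq_mul, inv_mul_eq_div] at hs
  rw [whittaker23_eq hh]
  simp only [exp_mul_prod_gammaOne_div hh, line_div]
  rw [integral_const_mul, hs]
  push_cast
  ring

/-! ### Absolute convergence -/

/-- The density cancels the two Gamma factors of `rightVec13`. On the contour `γ₂₁ - γ₂₂ = ε + it`,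
so a pole can occur only at `t = 0`, a null set. -/
theorem integrand13_eq {h : ℝ} (hh : 0 < h) (c : ℂ) (lam : Fin 3 → ℝ) (ε x : ℝ) {t : ℝ}
    (ht : t ≠ 0) :
    integrand13 h ε (leftVec c) (translated13 h lam x) t = c * exp x *
      (exp (-(ε + t * I) * x / h) * ∏ j, gammaOne (ε + t * I - lam j) h) := by
  have hc : (h : ℂ) ≠ 0 := by exact_mod_cast hh.ne'
  simp only [integrand13, translated13, leftVec]
  rw [expAct_eq x (E11 h) (fun g => g.g11 / h) (fun _ _ => rfl)]
  simp only [rightVec13, mu]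
  rw [if_pos ⟨by ring, by ring⟩]
  have him : ∀ (u : ℂ), u.im ≠ 0 → ∀ n : ℕ, u / h ≠ -n := by
    intro u hu n e
    rw [div_eq_iff hc] at e
    apply hu
    rw [e]
    simp
  have G1 := Gamma_ne_zero (him ((((ε - h / 2 : ℝ) : ℂ) + t * I) - -(h / 2)) (by simpa))
  have G2 := Gamma_ne_zero (him (-(h / 2) - (((ε - h / 2 : ℝ) : ℂ) + t * I)) (by simpa))
  have hj : ∀ j : Fin 3, (((ε - h / 2 : ℝ) : ℂ) + t * I) - lam j + h / 2 = ε + t * I - lam j :=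
    fun j => by push_cast; ring
  have E : exp (-x * ((((ε - h / 2 : ℝ) : ℂ) + t * I - h / 2) / h)) =
      exp x * exp (-(ε + t * I) * x / h) := by
    rw [← exp_add]
    congr 1
    push_cast
    field_simp
    ring
  simp only [hj]
  rw [E]
  generalize Gamma ((((ε - h / 2 : ℝ) : ℂ) + t * I - -(h / 2)) / h) = X at *
  generalize Gamma ((-(h / 2) - (((ε - h / 2 : ℝ) : ℂ) + t * I)) / h) = Y at *
  field_simp

theorem integrand23_eq {h : ℝ} (hh : 0 < h) (c : ℂ) (lam : Fin 3 → ℝ) (ε₁ ε₂ x : ℝ) (t : ℝ × ℝ) :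
    integrand23 h ε₁ ε₂ (leftVec c) (translated23 h lam x) t = c * exp x *
      (exp (-(ε₁ + t.1 * I + (ε₂ + t.2 * I)) * x / h) *
        (∏ j, (gammaOne (ε₁ + t.1 * I - lam j) h * gammaOne (ε₂ + t.2 * I - lam j) h)) /
        (gammaOne (ε₁ + t.1 * I - (ε₂ + t.2 * I)) h *
          gammaOne (ε₂ + t.2 * I - (ε₁ + t.1 * I)) h)) := by
  have hc : (h : ℂ) ≠ 0 := by exact_mod_cast hh.ne'
  simp only [integrand23, translated23, leftVec]
  rw [expAct_eq x _ (fun g => (g.g21 + g.g22) / h)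
    (fun φ g => by simp only [Pi.add_apply, E11, E22]; ring)]
  simp only [rightVec23, mu]
  rw [if_pos (by ring), gammaOne_mul_gammaOne_neg hh, ← sub_div, ← sub_div]
  have hj : ∀ (ε t : ℝ) (j : Fin 3),
      (((ε - h / 2 : ℝ) : ℂ) + t * I) - lam j + h / 2 = ε + t * I - lam j :=
    fun ε t j => by push_cast; ring
  have hs : ∀ ε ε' t t' : ℝ, (((ε - h / 2 : ℝ) : ℂ) + t * I) - (((ε' - h / 2 : ℝ) : ℂ) + t' * I) =
      ε + t * I - (ε' + t' * I) := fun ε ε' t t' => by push_cast; ring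
  have E : exp (-x * ((((ε₁ - h / 2 : ℝ) : ℂ) + t.1 * I + (((ε₂ - h / 2 : ℝ) : ℂ) + t.2 * I)) / h))
      = exp x * exp (-(ε₁ + t.1 * I + (ε₂ + t.2 * I)) * x / h) := by
    rw [← exp_add]
    congr 1
    push_cast
    field_simp
    ring
  simp only [hj, hs]
  rw [E]
  ring

theorem integrable_integrand13 {h : ℝ} (hh : 0 < h) (c : ℂ) {lam : Fin 3 → ℝ} {ε : ℝ}
    (hε : ∀ j, lam j < ε) (x : ℝ) :
    Integrable (integrand13 h ε (leftVec c) (translated13 h lam x)) := by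
  have hi := ((integrable_exp_mul_gammaProd (rescaledExponent h x) (a := fun j => lam j / h)
    (σ := ε / h) (fun j => div_lt_div_of_pos_right (hε j) hh)).comp_div hh.ne').const_mul
    (c * exp x * exp (-(Real.log h * ∑ j, lam j / h : ℝ)))
  refine hi.congr ?_
  have hae : ∀ᵐ t : ℝ, t ≠ 0 := by simp [ae_iff]
  filter_upwards [hae] with t ht
  rw [integrand13_eq hh c lam ε x ht, exp_mul_prod_gammaOne hh, line_div, mul_assoc]

theorem integrable_integrand23 {h : ℝ} (hh : 0 < h) (c : ℂ) {lam : Fin 3 → ℝ} {ε₁ ε₂ : ℝ}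
    (hε₁ : ∀ j, lam j < ε₁) (hε₂ : ∀ j, lam j < ε₂) (x : ℝ) :
    Integrable (integrand23 h ε₁ ε₂ (leftVec c) (translated23 h lam x)) := by
  have hi := ((integrable_barnesKernel (rescaledExponent h x) (b := fun j => lam j / h)
    (fun j => div_lt_div_of_pos_right (hε₁ j) hh)
    (fun j => div_lt_div_of_pos_right (hε₂ j) hh)).comp_smul (inv_ne_zero hh.ne')).const_mul
    (c * exp x * exp (-(Real.log h * (2 * ∑ j, lam j / h) : ℝ)))
  refine hi.congr (Eventually.of_forall fun t => ?_)
  simp only [integrand23_eq hh c, exp_mul_prod_gammaOne_div hh, line_div, Prod.smul_fst,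
    Prod.smul_snd, smul_eq_mul, inv_mul_eq_div, mul_assoc]

/-! ### Comparison of the two matrix elements -/

/-- The prefactors agree because `∑ λⱼ = 2 ∑ λ̃ⱼ`. Besides the `4π` of the inner integral, the
second contour variable contributes one more `I` and one more `h`. -/
theorem whittaker23_eq_whittaker13 {h : ℝ} (hh : 0 < h) {lam lamT : Fin 3 → ℝ}
    (hlam : ∀ i j k : Fin 3, i ≠ j → j ≠ k → i ≠ k → lam i = lamT j + lamT k)
    {ε ε₁ ε₂ : ℝ} (hε : ∀ j, lam j < ε) (hε₁ : ∀ j, lamT j < ε₁) (hε₂ : ∀ j, lamT j < ε₂)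
    (x : ℝ) (c : ℂ) :
    whittaker23 c h lamT ε₁ ε₂ x = 4 * Real.pi * I * h * whittaker13 c h lam ε x := by
  have hab : ∀ i j k : Fin 3, i ≠ j → j ≠ k → i ≠ k → lam i / h = lamT j / h + lamT k / h :=
    fun i j k h1 h2 h3 => by rw [hlam i j k h1 h2 h3, add_div]
  have hsum : ∑ j, lam j / h = 2 * ∑ j, lamT j / h := by
    rw [Fin.sum_univ_three, Fin.sum_univ_three,
      hab 0 1 2 (by decide) (by decide) (by decide), hab 1 0 2 (by decide) (by decide) (by decide),
      hab 2 0 1 (by decide) (by decide) (by decide)]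
    ring
  rw [whittaker23_eq_rescaled hh, whittaker13_eq_rescaled hh, hsum,
    integral_barnesKernel (rescaledExponent h x) (a := fun j => lam j / h) hab
      (fun j => div_lt_div_of_pos_right (hε j) hh) (fun j => div_lt_div_of_pos_right (hε₁ j) hh)
      (fun j => div_lt_div_of_pos_right (hε₂ j) hh)]
  ring

theorem whittaker13_smul {h : ℝ} (hh : 0 < h) (k c : ℂ) (lam : Fin 3 → ℝ) (ε x : ℝ) :
    whittaker13 (k * c) h lam ε x = k * whittaker13 c h lam ε x := by
  rw [whittaker13_eq hh, whittaker13_eq hh]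
  ring

end GZ

theorem mainTheorem8 (h : ℝ) (hh : 0 < h) (lam lamT : Fin 3 → ℝ)
    (hlam : ∀ i j k : Fin 3, i ≠ j → j ≠ k → i ≠ k → lam i = lamT j + lamT k)
    (ε ε₁ ε₂ : ℝ) (hε : ∀ j, lam j < ε) (hε₁ : ∀ j, lamT j < ε₁) (hε₂ : ∀ j, lamT j < ε₂)
    (x : ℝ) :
    (∀ c : ℂ, Integrable
      (GZ.integrand13 h ε (GZ.leftVec c) (GZ.translated13 h lam x))) ∧
    (∀ c : ℂ, Integrable
      (GZ.integrand23 h ε₁ ε₂ (GZ.leftVec c) (GZ.translated23 h lamT x))) ∧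
    GZ.whittaker13 (1 / (2 * Real.pi * Complex.I * h)) h lam ε x
      = GZ.whittaker23 (1 / (2 * (2 * Real.pi * Complex.I * h) ^ 2)) h lamT ε₁ ε₂ x ∧
    GZ.whittaker23 (1 / (2 * Real.pi * h)) h lamT ε₁ ε₂ x
      = -(4 * Real.pi * h) *
        GZ.whittaker13 (1 / (2 * Real.pi * Complex.I * h)) h lam ε x := by
  have hc : (h : ℂ) ≠ 0 := by exact_mod_cast hh.ne'
  have hpi : (Real.pi : ℂ) ≠ 0 := by exact_mod_cast Real.pi_ne_zero
  have hI : (Complex.I : ℂ) ≠ 0 := Complex.I_ne_zero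
  refine ⟨fun c => GZ.integrable_integrand13 hh c hε x,
    fun c => GZ.integrable_integrand23 hh c hε₁ hε₂ x, ?_, ?_⟩
  · rw [GZ.whittaker23_eq_whittaker13 hh hlam hε hε₁ hε₂,
      -- The ratio of the two normalizations is the inverse of the factor `4πih` relating the two
      -- functions at equal `c`.
      show (1 / (2 * (2 * Real.pi * Complex.I * h) ^ 2) : ℂ) =
        (1 / (4 * Real.pi * Complex.I * h)) * (1 / (2 * Real.pi * Complex.I * h)) by
          field_simp; ring,
      GZ.whittaker13_smul hh]
    field_simp
  · rw [GZ.whittaker23_eq_whittaker13 hh hlam hε hε₁ hε₂,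
      show (1 / (2 * Real.pi * h) : ℂ) = Complex.I * (1 / (2 * Real.pi * Complex.I * h)) by
        field_simp,
      GZ.whittaker13_smul hh]
    linear_combination (4 * Real.pi * h *
      GZ.whittaker13 (1 / (2 * Real.pi * Complex.I * h)) h lam ε x) * Complex.I_mul_I
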